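/- **Setting.** Let $X_1,\dots,X_N\in\mathbb R^{m\times T}$ be fixed matrices, $A^*\in\mathbb R^{m\times T}$, and let $Y_i=\operatorname{tr}(X_i'A^*)+\xi_i$, $i=1,\dots,N$, with random errors $\xi_i$. For $A\in\mathbb R^{m\times T}$ with singular values $\sigma_1(A)\ge\sigma_2(A)\ge\cdots\ge 0$ and $0<q<\infty$ put $\|A\|_{S_q}=\bigl(\sum_{j=1}^{\min(m,T)}\sigma_j(A)^q\bigr)^{1/q}$. Let $\mathcal L(A)=N^{-1/2}(\operatorname{tr}(X_1'A),\dots,\operatorname{tr}(X_N'A))\in\mathbb R^N$ and $\hat d_{2,N}(A,B)=|\mathcal L(A-B)|_2$, where $|\cdot|_2$ is the Euclidean norm. For an integer $1\le s\le\min(m,T)$ and $0<\nu<\infty$, the condition $\mathrm{RI}(s,\nu)$ holds with constant $\delta_s\in(0,1)$ if $$(1-\delta_s)\|A\|_{S_2}\le \nu|\mathcal L(A)|_2\le(1+\delta_s)\|A\|_{S_2}$$ for all $A\in\mathbb R^{m\times T}$ of rank at most $s$. **Theorem.** Let $0<p\le 1$. There exist a natural number $a_0=a_0(p)$ and constants $\delta_0=\delta_0(p)>0$,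 $C_1=C_1(p)>0$ depending only on $p$, and $C_2=C_2(p,q)>0$ depending only on $p$ and $q$, such that the following holds for every integer $a\ge a_0$ and all $m,T,N,r$, $X_1,\dots,X_N$, $A^*$ with $\operatorname{rank}(A^*)\le r$. Assume that $\mathrm{RI}((2+a)r,\nu)$ holds for some $0<\nu<\infty$ with a constant $0<\delta_{(2+a)r}\le\delta_0$. Let $0<\tau<\infty$, $\varepsilon>0$, and let $\hat A$ be a Schatten-$p$ estimator with $\lambda=4\tau$, that is, a minimizer over $A\in\mathbb R^{m\times T}$ of $$\frac1N\sum_{i=1}^N\bigl(Y_i-\operatorname{tr}(X_i'A)\bigr)^2+\lambda\|A\|_{S_p}^p .$$ Assume that for every $\delta>0$, with probability at least $1-\varepsilon$, $$\Bigl|\frac1N\sum_{i=1}^N\xi_i\operatorname{tr}\bigl(X_i'(\hat A-A^*)\bigr)\Bigr|\le\begin{cases}\tau\|\hat A-A^*\|_{S_1}, & p=1,\\[2pt] \frac{\delta}{2}\,\hat d_{2,N}(\hat A,A^*)^2+\tau\delta^{p-1}\|\hat A-A^*\|_{S_p}^p, & 0<p<1.\end{cases}$$ Then, with probability at least $1-\varepsilon$,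 $$\hat d_{2,N}(\hat A,A^*)^2\le C_1\,r\,\tau^{2/(2-p)}\nu^{2p/(2-p)}$$ and simultaneously $$\|\hat A-A^*\|_{S_q}^q\le C_2\,r\,\tau^{q/(2-p)}\nu^{2q/(2-p)}\qquad\text{for all } q\in[p,2].$$ -/

import Mathlib

open MeasureTheory

noncomputable section

namespace TraceRegression

variable {m T N : ℕ}

/-- The singular values `σ₀ ≥ σ₁ ≥ ⋯ ≥ 0` of a real matrix (indexed from `0`), i.e. those of the
linear map `ℝ^T → ℝ^m` between Euclidean spaces that it represents. -/
def singularValue (A : Matrix (Fin m) (Fin T) ℝ) (j : ℕ) : ℝ :=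
  (Matrix.toEuclideanLin A).singularValues j

/-- The Schatten (quasi-)norm `‖A‖_{S_p} = (∑_{j ≤ min(m,T)} σ_j(A)^p)^{1/p}`, for `0 < p < ∞`. -/
def schattenNorm (p : ℝ) (A : Matrix (Fin m) (Fin T) ℝ) : ℝ :=
  (∑ j ∈ Finset.range (min m T), singularValue A j ^ p) ^ (1 / p)

/-- The sampling operator `A ↦ (tr(X₁'A), …, tr(X_N'A)) / √N` with values in Euclidean `ℝ^N`. -/
def sampling (X : Fin N → Matrix (Fin m) (Fin T) ℝ) (A : Matrix (Fin m) (Fin T) ℝ) :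
    EuclideanSpace ℝ (Fin N) :=
  WithLp.toLp 2 (fun i => ((X i).transpose * A).trace / Real.sqrt N)

/-- The prediction (semi)distance `|𝓛(A - B)|₂`. -/
def predDist (X : Fin N → Matrix (Fin m) (Fin T) ℝ) (A B : Matrix (Fin m) (Fin T) ℝ) : ℝ :=
  ‖sampling X (A - B)‖

/-- The restricted isometry condition RI(`s`, `ν`) for the sampling operator, with the constant
`δ_s` equal to `δ`. -/
structure RestrictedIsometry (X : Fin N → Matrix (Fin m) (Fin T) ℝ) (s : ℕ) (ν δ : ℝ) : Prop where
  one_le : 1 ≤ s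
  le_min : s ≤ min m T
  scale_pos : 0 < ν
  const_pos : 0 < δ
  const_lt_one : δ < 1
  bounds : ∀ A : Matrix (Fin m) (Fin T) ℝ, A.rank ≤ s →
    (1 - δ) * schattenNorm 2 A ≤ ν * ‖sampling X A‖ ∧
      ν * ‖sampling X A‖ ≤ (1 + δ) * schattenNorm 2 A

/-- The penalized least squares criterion
`N⁻¹ ∑ (Y_i - tr(X_i'A))² + lam ‖A‖_{S_p}^p`. -/
def criterion (X : Fin N → Matrix (Fin m) (Fin T) ℝ) (Y : Fin N → ℝ) (p lam : ℝ)
    (A : Matrix (Fin m) (Fin T) ℝ) : ℝ :=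
  (1 / (N : ℝ)) * ∑ i, (Y i - ((X i).transpose * A).trace) ^ 2 + lam * schattenNorm p A ^ p

/-- `Ahat` is a Schatten-`p` estimator: a global minimizer of the criterion over all matrices. -/
def IsSchattenEstimator (X : Fin N → Matrix (Fin m) (Fin T) ℝ) (Y : Fin N → ℝ) (p lam : ℝ)
    (Ahat : Matrix (Fin m) (Fin T) ℝ) : Prop :=
  ∀ A : Matrix (Fin m) (Fin T) ℝ, criterion X Y p lam Ahat ≤ criterion X Y p lam A

/-- The bound on the stochastic term `N⁻¹ ∑ ξ_i tr(X_i'(Ahat - Astar))` with effective noise level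
`τ`, for one value of the free parameter `δ > 0` (which plays no role if `p = 1`). -/
def StochasticBound (X : Fin N → Matrix (Fin m) (Fin T) ℝ) (ξ : Fin N → ℝ) (p τ δ : ℝ)
    (Ahat Astar : Matrix (Fin m) (Fin T) ℝ) : Prop :=
  |(1 / (N : ℝ)) * ∑ i, ξ i * ((X i).transpose * (Ahat - Astar)).trace| ≤
    if p = 1 then τ * schattenNorm 1 (Ahat - Astar)
    else δ / 2 * predDist X Ahat Astar ^ 2 + τ * δ ^ (p - 1) * schattenNorm p (Ahat - Astar) ^ p

end TraceRegression

end

/-! Let `Δ = Ahat - Astar`, `d = predDist`, and let `S` be the sum of `p`-th powers of singular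
values. Comparing the criterion at `Ahat` and `Astar`, and taking `1/2` as the free parameter of the
noise bound, gives `d² ≤ 8τ(θ S(Δ) + S(Astar) - S(Ahat))` with `θ = 2^(-p) < 1`. Split `Δ = g₁ +
g₂`, with `g₁` of rank at most `2r` and `g₂` having row and column spaces orthogonal to those of
`Astar`. Additivity of `S` on orthogonal pieces and the `p`-triangle inequality turn this into `d² ≤
8τ((1+θ) S(g₁) - (1-θ) S(g₂))`. Hence `g₂` is dominated by `g₁` (a cone condition) and `d² ≤ 16τ
S(g₁)`. On the cone, cutting `g₂` into blocks of rank `ar` along its decreasing singular values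
makes all blocks but the first negligible for large `a`, so restricted isometry bounds the
Hilbert-Schmidt norms of `g₁` and `Δ` by multiples of `νd`. With `S(g₁) ≤ (2r)^(1-p/2) ‖g₁‖^p` this
closes into `d² ≤ Z d^p`, which bounds `d`, then `S(Δ)` and `‖Δ‖₂`; interpolation gives the
exponents in between. The delicate tool is the `p`-triangle inequality for `p < 1`. It follows from
`IsSVD.sum_min_le`: singular values minimize `∑ min(·, t)` over all decompositions into rank-one
atoms, and `x^p` is a positive mixture of the functions `min x t`. -/

namespace TraceRegression

open scoped InnerProductSpace

/-! ### Singular value decompositions and minimality of truncated sums. -/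

section SVD

variable {E F ι κ : Type*} [NormedAddCommGroup E] [InnerProductSpace ℝ E]
  [NormedAddCommGroup F] [InnerProductSpace ℝ F] [Fintype ι] [Fintype κ]

/-- The rank-one map `z ↦ ⟪y, z⟫ x`. -/
noncomputable def atom (x : F) (y : E) : E →ₗ[ℝ] F := (innerₛₗ ℝ y).smulRight x

@[simp]
theorem atom_apply (x : F) (y z : E) : atom x y z = ⟪y, z⟫_ℝ • x := rfl

/-- A (reduced) singular value decomposition `f = ∑ i, s i • u i ⊗ v i` of a linear map. -/
structure IsSVD (f : E →ₗ[ℝ] F) (s : ι → ℝ) (u : ι → F) (v : ι → E) : Prop where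
  pos : ∀ i, 0 < s i
  left : Orthonormal ℝ u
  right : Orthonormal ℝ v
  eq_sum : f = ∑ i, s i • atom (u i) (v i)

theorem finrank_range_sum_atom_le {α : Type*} (s : α → ℝ) (u : α → F) (v : α → E) (S : Finset α) :
    Module.finrank ℝ (LinearMap.range (∑ i ∈ S, s i • atom (u i) (v i))) ≤ S.card := by
  classical
  have : LinearMap.range (∑ i ∈ S, s i • atom (u i) (v i))
      ≤ Submodule.span ℝ (S.image u : Set F) := by
    rintro _ ⟨z, rfl⟩
    rw [LinearMap.sum_apply]
    refine Submodule.sum_mem _ fun i hi => ?_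
    rw [LinearMap.smul_apply, atom_apply]
    exact Submodule.smul_mem _ _ (Submodule.smul_mem _ _ (Submodule.subset_span (by
      simpa using ⟨i, hi, rfl⟩)))
  exact (Submodule.finrank_mono this).trans
    ((finrank_span_finset_le_card _).trans Finset.card_image_le)

/-- Bessel's inequality combined with Cauchy-Schwarz, for weights in `[0, 1]`. -/
theorem sum_mul_inner_mul_inner_le {u : ι → F} {v : ι → E} (hu : Orthonormal ℝ u)
    (hv : Orthonormal ℝ v) {c : ι → ℝ} (hc0 : ∀ i, 0 ≤ c i) (hc1 : ∀ i, c i ≤ 1) (x : F) (y : E) :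
    ∑ i, c i * (⟪v i, y⟫_ℝ * ⟪u i, x⟫_ℝ) ≤ ‖y‖ * ‖x‖ := by
  have hx : ∑ i, |⟪u i, x⟫_ℝ| ^ 2 ≤ ‖x‖ ^ 2 := by
    simpa using hu.sum_inner_products_le x (s := Finset.univ)
  have hy : ∑ i, |⟪v i, y⟫_ℝ| ^ 2 ≤ ‖y‖ ^ 2 := by
    simpa using hv.sum_inner_products_le y (s := Finset.univ)
  calc ∑ i, c i * (⟪v i, y⟫_ℝ * ⟪u i, x⟫_ℝ)
      ≤ ∑ i, |⟪v i, y⟫_ℝ| * |⟪u i, x⟫_ℝ| := by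
        refine Finset.sum_le_sum fun i _ => ?_
        rw [← abs_mul]
        refine (mul_le_mul_of_nonneg_left (le_abs_self _) (hc0 i)).trans ?_
        exact mul_le_of_le_one_left (abs_nonneg _) (hc1 i)
    _ ≤ √(∑ i, |⟪v i, y⟫_ℝ| ^ 2) * √(∑ i, |⟪u i, x⟫_ℝ| ^ 2) :=
        Real.sum_mul_le_sqrt_mul_sqrt _ _ _
    _ ≤ ‖y‖ * ‖x‖ :=
        mul_le_mul (Real.sqrt_le_iff.2 ⟨norm_nonneg _, hy⟩) (Real.sqrt_le_iff.2 ⟨norm_nonneg _, hx⟩)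
          (Real.sqrt_nonneg _) (norm_nonneg _)

/-- Expand in an orthonormal basis of `W` and swap the sums: by Bessel for `v`, each basis vector
contributes at most one. -/
theorem sum_norm_starProjection_sq_le {v : ι → E} (hv : Orthonormal ℝ v) (W : Submodule ℝ E)
    [FiniteDimensional ℝ W] :
    ∑ i, ‖W.starProjection (v i)‖ ^ 2 ≤ Module.finrank ℝ W := by
  have h1 : ∀ i, ‖W.starProjection (v i)‖ ^ 2
      = ∑ j, ⟪v i, (stdOrthonormalBasis ℝ W j : E)⟫_ℝ ^ 2 := by
    intro i
    have h2 := (stdOrthonormalBasis ℝ W).sum_sq_norm_inner_right (W.orthogonalProjectionOnto (v i))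
    rw [show ‖W.starProjection (v i)‖ = ‖W.orthogonalProjectionOnto (v i)‖ from rfl, ← h2]
    refine Finset.sum_congr rfl fun j _ => ?_
    rw [Submodule.coe_inner, Real.norm_eq_abs, sq_abs, real_inner_comm]
    congr 1
    exact Submodule.inner_starProjection_left_eq_right _ _ _ |>.trans (by
      rw [Submodule.starProjection_eq_self_iff.2 (Subtype.coe_prop _)])
  simp_rw [h1]
  rw [Finset.sum_comm]
  calc ∑ j, ∑ i, ⟪v i, (stdOrthonormalBasis ℝ W j : E)⟫_ℝ ^ 2
      ≤ ∑ j : Fin (Module.finrank ℝ W), (1 : ℝ) := by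
        refine Finset.sum_le_sum fun j _ => ?_
        have h3 := hv.sum_inner_products_le (stdOrthonormalBasis ℝ W j : E) (s := Finset.univ)
        rw [Submodule.norm_coe, OrthonormalBasis.norm_eq_one, one_pow] at h3
        simpa using h3
    _ = _ := by simp

namespace IsSVD

variable {f : E →ₗ[ℝ] F} {s : ι → ℝ} {u : ι → F} {v : ι → E}

theorem apply_eq (h : IsSVD f s u v) (z : E) : f z = ∑ i, (s i * ⟪v i, z⟫_ℝ) • u i := by
  rw [h.eq_sum]
  simp [LinearMap.sum_apply, smul_smul]

theorem inner_apply (h : IsSVD f s u v) (i : ι) (z : E) : ⟪u i, f z⟫_ℝ = s i * ⟪v i, z⟫_ℝ := by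
  classical
  rw [h.apply_eq, inner_sum]
  simp [inner_smul_right, orthonormal_iff_ite.1 h.left]

theorem apply_right (h : IsSVD f s u v) (i : ι) : f (v i) = s i • u i := by
  classical
  rw [h.apply_eq]
  simp [orthonormal_iff_ite.1 h.right]

theorem left_mem_range (h : IsSVD f s u v) (i : ι) : u i ∈ LinearMap.range f :=
  ⟨(s i)⁻¹ • v i, by rw [map_smul, h.apply_right, inv_smul_smul₀ (h.pos i).ne']⟩

theorem right_mem_ker_orthogonal (h : IsSVD f s u v) (i : ι) : v i ∈ (LinearMap.ker f)ᗮ := by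
  rw [Submodule.mem_orthogonal']
  intro z hz
  have := h.inner_apply i z
  rw [LinearMap.mem_ker.1 hz, inner_zero_right] at this
  exact (mul_eq_zero.1 this.symm).resolve_left (h.pos i).ne'

/-- The truncated sum of singular values is minimal among all decompositions into atoms. -/
theorem sum_min_le (h : IsSVD f s u v) {b : κ → ℝ} {x : κ → F} {y : κ → E}
    (hb : ∀ k, 0 ≤ b k) (hx : ∀ k, ‖x k‖ ≤ 1) (hy : ∀ k, ‖y k‖ ≤ 1)
    (hf : f = ∑ k, b k • atom (x k) (y k)) {t : ℝ} (ht : 0 < t) :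
    ∑ i, min (s i) t ≤ ∑ k, min (b k) t := by
  classical
  -- `K` collects the atoms heavier than `t`. They vanish on `Wᗮ`, while `W` has dimension at most
  -- `#K`.
  set K : Finset κ := Finset.univ.filter fun k => t < b k with hK
  set W : Submodule ℝ E := Submodule.span ℝ (K.image y : Set E) with hW
  have hdim : Module.finrank ℝ W ≤ K.card :=
    (finrank_span_finset_le_card _).trans Finset.card_image_le
  set c : ι → ℝ := fun i => min (s i) t / s i with hc
  have hcs : ∀ i, c i * s i = min (s i) t := fun i => div_mul_cancel₀ _ (h.pos i).ne'
  have hm : ∀ i, 0 ≤ min (s i) t := fun i => le_min (h.pos i).le ht.le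
  have hc0 : ∀ i, 0 ≤ c i := fun i => div_nonneg (hm i) (h.pos i).le
  have hc1 : ∀ i, c i ≤ 1 := fun i => (div_le_one (h.pos i)).2 (min_le_left _ _)
  -- Split `1 = ‖v i‖²` along `W` and `Wᗮ`. The `W` part costs at most `t · dim W`; the `Wᗮ` part
  -- sees only the light atoms, each paired with total weight at most one.
  have hsplit : ∀ i, min (s i) t = min (s i) t * ‖W.starProjection (v i)‖ ^ 2
      + c i * ⟪u i, f (Wᗮ.starProjection (v i))⟫_ℝ := by
    intro i
    have h1 : ⟪v i, W.starProjection (v i)⟫_ℝ = ‖W.starProjection (v i)‖ ^ 2 := by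
      rw [← real_inner_self_eq_norm_sq, Submodule.inner_starProjection_left_eq_right,
        Submodule.starProjection_eq_self_iff.2 (Submodule.starProjection_apply_mem _ _)]
    have h2 : ⟪v i, W.starProjection (v i)⟫_ℝ + ⟪v i, Wᗮ.starProjection (v i)⟫_ℝ = 1 := by
      rw [← inner_add_right, Submodule.starProjection_add_starProjection_orthogonal,
        real_inner_self_eq_norm_sq, h.right.1 i, one_pow]
    rw [h.inner_apply, ← mul_assoc, hcs, ← h1, ← mul_add, h2, mul_one]
  have hfirst : ∑ i, min (s i) t * ‖W.starProjection (v i)‖ ^ 2 ≤ K.card * t := by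
    calc ∑ i, min (s i) t * ‖W.starProjection (v i)‖ ^ 2
        ≤ ∑ i, t * ‖W.starProjection (v i)‖ ^ 2 :=
          Finset.sum_le_sum fun i _ => mul_le_mul_of_nonneg_right (min_le_right _ _) (sq_nonneg _)
      _ = t * ∑ i, ‖W.starProjection (v i)‖ ^ 2 := by rw [Finset.mul_sum]
      _ ≤ t * K.card := mul_le_mul_of_nonneg_left
          ((sum_norm_starProjection_sq_le h.right W).trans (by exact_mod_cast hdim)) ht.le
      _ = _ := mul_comm _ _
  have hsecond : ∑ i, c i * ⟪u i, f (Wᗮ.starProjection (v i))⟫_ℝ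
      ≤ ∑ k ∈ Finset.univ.filter (fun k => ¬ t < b k), b k := by
    have h1 : ∀ i, ⟪u i, f (Wᗮ.starProjection (v i))⟫_ℝ
        = ∑ k, b k * (⟪v i, Wᗮ.starProjection (y k)⟫_ℝ * ⟪u i, x k⟫_ℝ) := by
      intro i
      rw [hf, LinearMap.sum_apply, inner_sum]
      refine Finset.sum_congr rfl fun k _ => ?_
      rw [LinearMap.smul_apply, atom_apply, inner_smul_right, inner_smul_right,
        ← Submodule.inner_starProjection_left_eq_right, real_inner_comm]
    simp_rw [h1, Finset.mul_sum]
    rw [Finset.sum_comm, Finset.sum_filter]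
    refine Finset.sum_le_sum fun k _ => ?_
    by_cases hk : t < b k
    · have hyk : y k ∈ W := Submodule.subset_span (by
        simp only [Finset.coe_image]
        exact ⟨k, by simpa [hK] using hk, rfl⟩)
      have : Wᗮ.starProjection (y k) = 0 := by
        rw [Submodule.starProjection_apply_eq_zero_iff]
        exact Submodule.le_orthogonal_orthogonal W hyk
      simp [this, hk]
    · rw [if_pos hk]
      have h2 : ∑ i, c i * (⟪v i, Wᗮ.starProjection (y k)⟫_ℝ * ⟪u i, x k⟫_ℝ) ≤ 1 := by
        refine (sum_mul_inner_mul_inner_le h.left h.right hc0 hc1 _ _).trans ?_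
        exact mul_le_one₀ ((Submodule.norm_starProjection_apply_le _ _).trans (hy k))
          (norm_nonneg _) (hx k)
      calc _ = b k * ∑ i, c i * (⟪v i, Wᗮ.starProjection (y k)⟫_ℝ * ⟪u i, x k⟫_ℝ) := by
            rw [Finset.mul_sum]; exact Finset.sum_congr rfl fun i _ => by ring
        _ ≤ b k := mul_le_of_le_one_right (hb k) h2
  calc ∑ i, min (s i) t = _ := Finset.sum_congr rfl fun i _ => hsplit i
    _ ≤ K.card * t + ∑ k ∈ Finset.univ.filter (fun k => ¬ t < b k), b k := by
        rw [Finset.sum_add_distrib]; exact add_le_add hfirst hsecond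
    _ = ∑ k, min (b k) t := by
        rw [← Finset.sum_filter_add_sum_filter_not Finset.univ (fun k => t < b k)]
        congr 1
        · rw [Finset.sum_congr rfl (g := fun _ => t), Finset.sum_const, nsmul_eq_mul]
          intro k hk
          exact min_eq_right (Finset.mem_filter.1 hk).2.le
        · refine Finset.sum_congr rfl fun k hk => ?_
          exact (min_eq_left (not_lt.1 (Finset.mem_filter.1 hk).2)).symm

end IsSVD

end SVD

/-! ### Powers as mixtures of truncations. -/

section PowerRepresentation

/-- The integrand is `t^(p-1)` up to `x`, integrable since `p > 0`, and `x t^(p-2)` beyond,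
integrable since `p < 1`. -/
theorem integrableOn_rpow_mul_min {p x : ℝ} (hp0 : 0 < p) (hp1 : p < 1) (hx : 0 < x) :
    IntegrableOn (fun t : ℝ => t ^ (p - 2) * min x t) (Set.Ioi 0) := by
  have h1 : IntegrableOn (fun t : ℝ => t ^ (p - 2) * min x t) (Set.Ioc 0 x) := by
    have h : IntegrableOn (fun t : ℝ => t ^ (p - 1)) (Set.Ioc 0 x) :=
      (intervalIntegrable_iff_integrableOn_Ioc_of_le hx.le).1
        (intervalIntegral.intervalIntegrable_rpow' (by linarith))
    refine h.congr_fun (fun t ht => ?_) measurableSet_Ioc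
    simp only
    rw [min_eq_right ht.2, ← Real.rpow_add_one ht.1.ne']
    ring_nf
  have h2 : IntegrableOn (fun t : ℝ => t ^ (p - 2) * min x t) (Set.Ioi x) := by
    have h : IntegrableOn (fun t : ℝ => t ^ (p - 2) * x) (Set.Ioi x) :=
      (integrableOn_Ioi_rpow_of_lt (by linarith) hx).mul_const x
    refine h.congr_fun (fun t ht => ?_) measurableSet_Ioi
    simp only
    rw [min_eq_left (Set.mem_Ioi.1 ht).le]
  rw [← Set.Ioc_union_Ioi_eq_Ioi hx.le]
  exact h1.union h2

/-- The power function `x ↦ x ^ p`, `0 < p < 1`, as a mixture of the functions `min x t`. -/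
theorem integral_rpow_mul_min {p x : ℝ} (hx : 0 < x) :
    ∫ t in Set.Ioi (0 : ℝ), t ^ (p - 2) * min x t
      = x ^ p * ∫ t in Set.Ioi (0 : ℝ), t ^ (p - 2) * min 1 t := by
  -- Substitute `t ↦ x t`; the powers of `x` collect to `x^(p-2) · x · x = x^p`.
  have h := integral_comp_mul_left_Ioi' (fun t : ℝ => t ^ (p - 2) * min x t) 0 hx
  rw [mul_zero] at h
  rw [← h, smul_eq_mul, ← integral_const_mul, ← integral_const_mul]
  refine setIntegral_congr_fun measurableSet_Ioi fun t ht => ?_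
  have ht : 0 < t := ht
  have h1 : min x (x * t) = x * min 1 t := by rw [mul_min_of_nonneg _ _ hx.le, mul_one]
  rw [h1, Real.mul_rpow hx.le ht.le]
  have h2 : x ^ p = x * x ^ (p - 2) * x := by
    rw [mul_comm x, ← Real.rpow_add_one hx.ne', ← Real.rpow_add_one hx.ne']
    ring_nf
  rw [h2]
  ring

theorem integral_rpow_mul_min_one_pos {p : ℝ} (hp0 : 0 < p) (hp1 : p < 1) :
    0 < ∫ t in Set.Ioi (0 : ℝ), t ^ (p - 2) * min 1 t := by
  rw [setIntegral_pos_iff_support_of_nonneg_ae]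
  · refine lt_of_lt_of_le (b := volume (Set.Ioi (0 : ℝ))) (by simp) (measure_mono fun t ht => ?_)
    have ht' : 0 < t := ht
    exact ⟨(mul_pos (Real.rpow_pos_of_pos ht' _) (lt_min one_pos ht')).ne', ht⟩
  · refine (ae_restrict_iff' measurableSet_Ioi).2 (Filter.Eventually.of_forall fun t ht => ?_)
    have ht' : 0 < t := ht
    exact (mul_pos (Real.rpow_pos_of_pos ht' _) (lt_min one_pos ht')).le
  · exact integrableOn_rpow_mul_min hp0 hp1 one_pos

theorem sum_rpow_mul_integral {ι : Type*} [Fintype ι] {c : ι → ℝ} {p : ℝ} (hp0 : 0 < p)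
    (hp1 : p < 1) (hc : ∀ i, 0 < c i) :
    (∑ i, c i ^ p) * ∫ t in Set.Ioi (0 : ℝ), t ^ (p - 2) * min 1 t
      = ∫ t in Set.Ioi (0 : ℝ), t ^ (p - 2) * ∑ i, min (c i) t := by
  simp_rw [Finset.mul_sum]
  rw [integral_finsetSum _ fun i _ => integrableOn_rpow_mul_min hp0 hp1 (hc i), Finset.sum_mul]
  exact Finset.sum_congr rfl fun i _ => (integral_rpow_mul_min (hc i)).symm

/-- Domination of all truncated sums implies domination of the sums of `p`-th powers, `p ≤ 1`. -/
theorem sum_rpow_le_sum_rpow_of_sum_min_le {ι κ : Type*} [Fintype ι] [Fintype κ] {s : ι → ℝ}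
    {b : κ → ℝ} (hs : ∀ i, 0 < s i) (hb : ∀ k, 0 < b k)
    (h : ∀ t, 0 < t → ∑ i, min (s i) t ≤ ∑ k, min (b k) t) {p : ℝ} (hp0 : 0 < p) (hp1 : p ≤ 1) :
    ∑ i, s i ^ p ≤ ∑ k, b k ^ p := by
  rcases hp1.eq_or_lt with rfl | hp1
  -- At `p = 1` the mixture integral diverges, but a single `t` above every term makes the
  -- truncation trivial.
  · simp only [Real.rpow_one]
    set t := ∑ i, s i + ∑ k, b k + 1 with ht
    have hS : 0 ≤ ∑ i, s i := Finset.sum_nonneg fun i _ => (hs i).le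
    have hB : 0 ≤ ∑ k, b k := Finset.sum_nonneg fun i _ => (hb i).le
    have h1 := h t (by linarith)
    have h2 : ∀ i, min (s i) t = s i := fun i => min_eq_left (by
      have := Finset.single_le_sum (fun i _ => (hs i).le) (Finset.mem_univ i)
      linarith)
    have h3 : ∀ i, min (b i) t = b i := fun i => min_eq_left (by
      have := Finset.single_le_sum (fun i _ => (hb i).le) (Finset.mem_univ i)
      linarith)
    simpa [h2, h3] using h1
  · have hint : ∀ {c : ℝ}, 0 < c → Integrable (fun t : ℝ => t ^ (p - 2) * min c t)
        (volume.restrict (Set.Ioi 0)) := fun hc => integrableOn_rpow_mul_min hp0 hp1 hc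
    refine le_of_mul_le_mul_right ?_ (integral_rpow_mul_min_one_pos hp0 hp1)
    rw [sum_rpow_mul_integral hp0 hp1 hs, sum_rpow_mul_integral hp0 hp1 hb]
    refine setIntegral_mono_on ?_ ?_ measurableSet_Ioi fun t ht =>
      mul_le_mul_of_nonneg_left (h t ht) (Real.rpow_nonneg (le_of_lt ht) _)
    · simp_rw [Finset.mul_sum]
      exact integrable_finsetSum _ fun i _ => hint (hs i)
    · simp_rw [Finset.mul_sum]
      exact integrable_finsetSum _ fun i _ => hint (hb i)

end PowerRepresentation

/-- Applied to a second decomposition of `f`, this shows that the sum is intrinsic; applied to the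
concatenated decompositions of two summands, it is the `p`-triangle inequality. -/
theorem IsSVD.sum_rpow_le {E F ι κ : Type*} [NormedAddCommGroup E] [InnerProductSpace ℝ E]
    [NormedAddCommGroup F] [InnerProductSpace ℝ F] [Fintype ι] [Fintype κ]
    {f : E →ₗ[ℝ] F} {s : ι → ℝ} {u : ι → F} {v : ι → E}
    (h : IsSVD f s u v) {b : κ → ℝ} {x : κ → F} {y : κ → E}
    (hb : ∀ k, 0 < b k) (hx : ∀ k, ‖x k‖ ≤ 1) (hy : ∀ k, ‖y k‖ ≤ 1)
    (hf : f = ∑ k, b k • atom (x k) (y k)) {p : ℝ} (hp0 : 0 < p) (hp1 : p ≤ 1) :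
    ∑ i, s i ^ p ≤ ∑ k, b k ^ p :=
  sum_rpow_le_sum_rpow_of_sum_min_le h.pos hb
    (fun _ ht => h.sum_min_le (fun k => (hb k).le) hx hy hf ht) hp0 hp1

/-! ### Hilbert-Schmidt geometry. -/

section HilbertSchmidt

variable {E F ι : Type*} [NormedAddCommGroup E] [InnerProductSpace ℝ E] [FiniteDimensional ℝ E]
  [NormedAddCommGroup F] [InnerProductSpace ℝ F] [Fintype ι]

/-- The Hilbert-Schmidt embedding: the images of a fixed orthonormal basis. -/
noncomputable def hsVec :
    (E →ₗ[ℝ] F) →ₗ[ℝ] PiLp 2 (fun _ : Fin (Module.finrank ℝ E) => F) where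
  toFun f := WithLp.toLp 2 fun i => f (stdOrthonormalBasis ℝ E i)
  map_add' _ _ := rfl
  map_smul' _ _ := rfl

theorem hsVec_apply (f : E →ₗ[ℝ] F) (i : Fin (Module.finrank ℝ E)) :
    hsVec f i = f (stdOrthonormalBasis ℝ E i) := rfl

/-- Expand `y` in the basis. This makes the atoms of a decomposition orthonormal and reduces
orthogonality of maps to their values on singular vectors. -/
theorem inner_hsVec_atom (f : E →ₗ[ℝ] F) (x : F) (y : E) :
    ⟪hsVec f, hsVec (atom x y)⟫_ℝ = ⟪f y, x⟫_ℝ := by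
  conv_rhs => rw [← (stdOrthonormalBasis ℝ E).sum_repr' y, map_sum, sum_inner]
  rw [PiLp.inner_apply]
  refine Finset.sum_congr rfl fun i _ => ?_
  rw [hsVec_apply, hsVec_apply, atom_apply, map_smul, inner_smul_left, inner_smul_right,
    real_inner_comm y]
  rfl

theorem IsSVD.orthonormal_hsVec_atom {f : E →ₗ[ℝ] F} {s : ι → ℝ} {u : ι → F} {v : ι → E}
    (h : IsSVD f s u v) : Orthonormal ℝ fun i => hsVec (atom (u i) (v i)) := by
  classical
  rw [orthonormal_iff_ite]
  intro i j
  rw [inner_hsVec_atom, atom_apply, inner_smul_left, orthonormal_iff_ite.1 h.left,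
    orthonormal_iff_ite.1 h.right]
  split_ifs <;> simp

theorem IsSVD.norm_hsVec_sum_sq {f : E →ₗ[ℝ] F} {s : ι → ℝ} {u : ι → F} {v : ι → E}
    (h : IsSVD f s u v) (S : Finset ι) :
    ‖hsVec (∑ i ∈ S, s i • atom (u i) (v i))‖ ^ 2 = ∑ i ∈ S, s i ^ 2 := by
  rw [← real_inner_self_eq_norm_sq, map_sum]
  simp_rw [map_smul]
  rw [h.orthonormal_hsVec_atom.inner_sum]
  simp [sq]

end HilbertSchmidt

/-! ### Schatten sums: invariance, triangle inequality, additivity. -/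

section SchattenSum

variable {E F ι κ : Type*} [NormedAddCommGroup E] [InnerProductSpace ℝ E] [FiniteDimensional ℝ E]
  [NormedAddCommGroup F] [InnerProductSpace ℝ F] [FiniteDimensional ℝ F]
  [Fintype ι] [Fintype κ]

/-- The sum of the `q`-th powers of the nonzero singular values. -/
noncomputable def schattenSum (q : ℝ) (f : E →ₗ[ℝ] F) : ℝ :=
  ∑ j ∈ Finset.range (Module.finrank ℝ (LinearMap.range f)), f.singularValues j ^ q

theorem schattenSum_nonneg (q : ℝ) (f : E →ₗ[ℝ] F) : 0 ≤ schattenSum q f :=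
  Finset.sum_nonneg fun j _ => Real.rpow_nonneg (f.singularValues_nonneg j) q

theorem schattenSum_eq_sum_fin (q : ℝ) (f : E →ₗ[ℝ] F) :
    schattenSum q f
      = ∑ j : Fin (Module.finrank ℝ (LinearMap.range f)), f.singularValues j ^ q :=
  Finset.sum_range _

/-- The right vectors are the eigenvectors of `f* f` with nonzero eigenvalue, the left ones their
normalized images; `f` kills the remaining eigenvectors. -/
theorem exists_isSVD (f : E →ₗ[ℝ] F) :
    ∃ (u : Fin (Module.finrank ℝ (LinearMap.range f)) → F)
      (v : Fin (Module.finrank ℝ (LinearMap.range f)) → E),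
      IsSVD f (fun j : Fin (Module.finrank ℝ (LinearMap.range f)) => f.singularValues j) u v := by
  classical
  set n := Module.finrank ℝ (LinearMap.range f) with hn
  have hnE : n ≤ Module.finrank ℝ E := LinearMap.finrank_range_le f
  set e := f.isSymmetric_adjoint_comp_self.eigenvectorBasis rfl with he
  have hinner : ∀ i j, ⟪f (e i), f (e j)⟫_ℝ = if i = j then f.singularValues i ^ 2 else 0 := by
    intro i j
    rw [← LinearMap.adjoint_inner_left, ← LinearMap.comp_apply,
      f.isSymmetric_adjoint_comp_self.apply_eigenvectorBasis rfl i, inner_smul_left,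
      ← he, orthonormal_iff_ite.1 e.orthonormal, f.sq_singularValues_fin rfl i]
    simp
  have hpos : ∀ j : Fin n, 0 < f.singularValues j := fun j =>
    f.singularValues_pos_iff_lt_finrank_range.2 j.2
  set v : Fin n → E := fun j => e (Fin.castLE hnE j) with hv
  set u : Fin n → F := fun j => (f.singularValues j)⁻¹ • f (v j) with hu
  have hfv : ∀ j, f (v j) = f.singularValues j • u j := fun j =>
    (smul_inv_smul₀ (hpos j).ne' _).symm
  have hvo : Orthonormal ℝ v := e.orthonormal.comp _ (Fin.castLE_injective hnE)
  refine ⟨u, v, hpos, ?_, hvo, ?_⟩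
  · rw [orthonormal_iff_ite]
    intro i j
    simp only [hu, hv, inner_smul_left, inner_smul_right, hinner, (Fin.castLE_injective hnE).eq_iff]
    split_ifs with hij
    · subst hij
      have := (hpos i).ne'
      simp only [Fin.val_castLE, map_inv₀, conj_trivial]
      field_simp
    · simp
  · refine e.toBasis.ext fun k => ?_
    simp only [OrthonormalBasis.coe_toBasis, LinearMap.sum_apply, LinearMap.smul_apply, atom_apply]
    by_cases hk : (k : ℕ) < n
    · have hk' : e k = v ⟨k, hk⟩ := rfl
      rw [hk', hfv]
      simp [orthonormal_iff_ite.1 hvo]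
    · have h0 : f (e k) = 0 := by
        have := hinner k k
        rw [if_pos rfl, f.singularValues_eq_zero_iff_le_finrank_range.2 (not_lt.1 hk)] at this
        simpa using this
      rw [h0]
      refine (Finset.sum_eq_zero fun j _ => ?_).symm
      have : ⟪v j, e k⟫_ℝ = 0 := by
        simp only [hv]
        rw [orthonormal_iff_ite.1 e.orthonormal, if_neg]
        rintro rfl
        exact hk j.2
      simp [this]

/-- The sum of `p`-th powers does not depend on the singular value decomposition. -/
theorem IsSVD.schattenSum_eq {f : E →ₗ[ℝ] F} {s : ι → ℝ} {u : ι → F} {v : ι → E}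
    (h : IsSVD f s u v) {p : ℝ} (hp0 : 0 < p) (hp1 : p ≤ 1) :
    schattenSum p f = ∑ i, s i ^ p := by
  obtain ⟨u', v', h'⟩ := exists_isSVD f
  rw [schattenSum_eq_sum_fin]
  exact le_antisymm
    (h'.sum_rpow_le h.pos (fun i => (h.left.1 i).le) (fun i => (h.right.1 i).le) h.eq_sum hp0 hp1)
    (h.sum_rpow_le h'.pos (fun i => (h'.left.1 i).le) (fun i => (h'.right.1 i).le) h'.eq_sum
      hp0 hp1)

/-- The `p`-triangle inequality for Schatten classes, `0 < p ≤ 1`. -/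
theorem schattenSum_add_le (f g : E →ₗ[ℝ] F) {p : ℝ} (hp0 : 0 < p) (hp1 : p ≤ 1) :
    schattenSum p (f + g) ≤ schattenSum p f + schattenSum p g := by
  obtain ⟨u, v, h⟩ := exists_isSVD (f + g)
  obtain ⟨u₁, v₁, h₁⟩ := exists_isSVD f
  obtain ⟨u₂, v₂, h₂⟩ := exists_isSVD g
  have := h.sum_rpow_le
    (b := Sum.elim (fun j : Fin (Module.finrank ℝ (LinearMap.range f)) => f.singularValues j)
      (fun j : Fin (Module.finrank ℝ (LinearMap.range g)) => g.singularValues j))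
    (x := Sum.elim u₁ u₂) (y := Sum.elim v₁ v₂)
    (by rintro (j | j); exacts [h₁.pos j, h₂.pos j])
    (by rintro (j | j); exacts [(h₁.left.1 j).le, (h₂.left.1 j).le])
    (by rintro (j | j); exacts [(h₁.right.1 j).le, (h₂.right.1 j).le])
    (by rw [Fintype.sum_sum_type]; simpa using congrArg₂ (· + ·) h₁.eq_sum h₂.eq_sum)
    hp0 hp1
  rw [Fintype.sum_sum_type] at this
  simpa [schattenSum_eq_sum_fin] using this

theorem schattenSum_neg (f : E →ₗ[ℝ] F) {p : ℝ} (hp0 : 0 < p) (hp1 : p ≤ 1) :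
    schattenSum p (-f) = schattenSum p f := by
  obtain ⟨u, v, h⟩ := exists_isSVD f
  have h' : IsSVD (-f) (fun j : Fin (Module.finrank ℝ (LinearMap.range f)) => f.singularValues j)
      (fun j => -u j) v := by
    refine ⟨h.pos, ?_, h.right, ?_⟩
    · rw [orthonormal_iff_ite]
      intro i j
      rw [inner_neg_neg]
      exact orthonormal_iff_ite.1 h.left i j
    · ext1 z
      simp [h.apply_eq z, smul_smul]
  rw [h'.schattenSum_eq hp0 hp1, schattenSum_eq_sum_fin]

/-- Additivity of the Schatten sums for maps with orthogonal row and column spaces. -/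
theorem schattenSum_add_of_orthogonal (f g : E →ₗ[ℝ] F) {p : ℝ} (hp0 : 0 < p) (hp1 : p ≤ 1)
    (hrange : LinearMap.range f ⟂ LinearMap.range g)
    (hker : (LinearMap.ker f)ᗮ ⟂ (LinearMap.ker g)ᗮ) :
    schattenSum p (f + g) = schattenSum p f + schattenSum p g := by
  obtain ⟨u₁, v₁, h₁⟩ := exists_isSVD f
  obtain ⟨u₂, v₂, h₂⟩ := exists_isSVD g
  have hu : ∀ i j, ⟪u₁ i, u₂ j⟫_ℝ = 0 := fun i j =>
    Submodule.isOrtho_iff_inner_eq.1 hrange _ (h₁.left_mem_range i) _ (h₂.left_mem_range j)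
  have hv : ∀ i j, ⟪v₁ i, v₂ j⟫_ℝ = 0 := fun i j =>
    Submodule.isOrtho_iff_inner_eq.1 hker _ (h₁.right_mem_ker_orthogonal i) _
      (h₂.right_mem_ker_orthogonal j)
  have h : IsSVD (f + g)
      (Sum.elim (fun j => f.singularValues j) (fun j => g.singularValues j)
        : Fin (Module.finrank ℝ (LinearMap.range f)) ⊕ Fin (Module.finrank ℝ (LinearMap.range g))
          → ℝ) (Sum.elim u₁ u₂) (Sum.elim v₁ v₂) := by
    refine ⟨by rintro (j | j); exacts [h₁.pos j, h₂.pos j], ?_, ?_, ?_⟩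
    · rw [orthonormal_iff_ite]
      rintro (i | i) (j | j)
      · simpa using orthonormal_iff_ite.1 h₁.left i j
      · simpa using hu i j
      · simpa [real_inner_comm] using hu j i
      · simpa using orthonormal_iff_ite.1 h₂.left i j
    · rw [orthonormal_iff_ite]
      rintro (i | i) (j | j)
      · simpa using orthonormal_iff_ite.1 h₁.right i j
      · simpa using hv i j
      · simpa [real_inner_comm] using hv j i
      · simpa using orthonormal_iff_ite.1 h₂.right i j
    · rw [Fintype.sum_sum_type]
      simpa using congrArg₂ (· + ·) h₁.eq_sum h₂.eq_sum
  rw [h.schattenSum_eq hp0 hp1, Fintype.sum_sum_type]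
  simp [schattenSum_eq_sum_fin]

theorem schattenSum_two (f : E →ₗ[ℝ] F) : schattenSum 2 f = ‖hsVec f‖ ^ 2 := by
  obtain ⟨u, v, h⟩ := exists_isSVD f
  have := h.norm_hsVec_sum_sq Finset.univ
  rw [← h.eq_sum] at this
  rw [this, schattenSum_eq_sum_fin]
  simp

/-- Comparison of Schatten sums with the Hilbert-Schmidt norm on maps of bounded rank. -/
theorem schattenSum_le_rank_rpow_mul (f : E →ₗ[ℝ] F) {p : ℝ} (hp0 : 0 < p) (hp1 : p ≤ 1) {n : ℕ}
    (hn : Module.finrank ℝ (LinearMap.range f) ≤ n) :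
    schattenSum p f ≤ (n : ℝ) ^ (1 - p / 2) * ‖hsVec f‖ ^ p := by
  -- Power mean inequality with exponent `2/p ≥ 1` for the numbers `σ_j^p`; the root `p/2` is taken
  -- at the end.
  have h1 := Real.rpow_sum_le_const_mul_sum_rpow
    (Finset.range (Module.finrank ℝ (LinearMap.range f))) (fun j => f.singularValues j ^ p)
    (p := 2 / p) (by rw [le_div_iff₀ hp0]; linarith)
  have hcard : ((Finset.range (Module.finrank ℝ (LinearMap.range f))).card : ℝ) ≤ n := by
    simpa using hn
  have h2 : ∀ j, |f.singularValues j ^ p| = f.singularValues j ^ p := fun j =>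
    abs_of_nonneg (Real.rpow_nonneg (f.singularValues_nonneg j) p)
  have h3 : ∀ j, (f.singularValues j ^ p) ^ (2 / p) = f.singularValues j ^ (2 : ℝ) := fun j => by
    rw [← Real.rpow_mul (f.singularValues_nonneg j), mul_div_cancel₀ _ hp0.ne']
  simp only [h2, h3] at h1
  change schattenSum p f ^ (2 / p) ≤ _ * schattenSum 2 f at h1
  rw [schattenSum_two] at h1
  have hexp : 0 ≤ 2 / p - 1 := by rw [sub_nonneg, le_div_iff₀ hp0]; linarith
  have h4 : schattenSum p f ^ (2 / p) ≤ (n : ℝ) ^ (2 / p - 1) * ‖hsVec f‖ ^ 2 :=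
    h1.trans (mul_le_mul_of_nonneg_right (Real.rpow_le_rpow (Nat.cast_nonneg _) hcard hexp)
      (sq_nonneg _))
  have h5 := Real.rpow_le_rpow (Real.rpow_nonneg (schattenSum_nonneg p f) _) h4
    (by positivity : 0 ≤ p / 2)
  rw [← Real.rpow_mul (schattenSum_nonneg p f), Real.mul_rpow (by positivity) (by positivity),
    ← Real.rpow_mul (Nat.cast_nonneg _), ← Real.rpow_natCast ‖hsVec f‖ 2,
    ← Real.rpow_mul (norm_nonneg _)] at h5
  have e1 : 2 / p * (p / 2) = 1 := by field_simp
  have e2 : (2 / p - 1) * (p / 2) = 1 - p / 2 := by field_simp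
  have e3 : ((2 : ℕ) : ℝ) * (p / 2) = p := by push_cast; ring
  rwa [e1, e2, e3, Real.rpow_one] at h5

end SchattenSum

/-! ### Blocks of a decreasing sequence. -/

section Blocks

/-- Block decomposition of a decreasing sequence: the `ℓ²` norms of all blocks of length `k` but
the first one are summable in terms of the `ℓᵖ` quasi-norm of the sequence. -/
theorem sum_sqrt_block_le {σ : ℕ → ℝ} (hσ : Antitone σ) (hσ0 : ∀ j, 0 ≤ σ j) (n : ℕ) {k : ℕ}
    (hk : 0 < k) {p : ℝ} (hp0 : 0 < p) (hp1 : p ≤ 1) :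
    ∑ l ∈ Finset.range n, √(∑ j ∈ (Finset.range n).filter (fun j => j / k = l + 1), σ j ^ 2)
      ≤ (k : ℝ) ^ (1 / 2 - 1 / p) * (∑ j ∈ Finset.range n, σ j ^ p) ^ (1 / p) := by
  set S : ℝ := ∑ j ∈ Finset.range n, σ j ^ p with hS
  set B : ℕ → ℝ := fun l => ∑ j ∈ (Finset.range n).filter (fun j => j / k = l), σ j ^ p with hB
  have hkR : (0 : ℝ) < k := by exact_mod_cast hk
  have hpow : ∀ j, 0 ≤ σ j ^ p := fun j => Real.rpow_nonneg (hσ0 j) p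
  have hB0 : ∀ l, 0 ≤ B l := fun l => Finset.sum_nonneg fun j _ => hpow j
  have hBS : ∀ l, B l ≤ S := fun l =>
    Finset.sum_le_sum_of_subset_of_nonneg (Finset.filter_subset _ _) fun j _ _ => hpow j
  have hp' : 1 ≤ 1 / p := by rw [le_div_iff₀ hp0]; linarith
  have hsumB : ∑ l ∈ Finset.range n, B l = S := by
    refine Finset.sum_fiberwise_of_maps_to (fun j hj => ?_) _
    exact Finset.mem_range.2 ((Nat.div_le_self _ _).trans_lt (Finset.mem_range.1 hj))
  have hblock : ∀ l, √(∑ j ∈ (Finset.range n).filter (fun j => j / k = l + 1), σ j ^ 2)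
      ≤ (k : ℝ) ^ (1 / 2 - 1 / p) * (B l * S ^ (1 / p - 1)) := by
    intro l
    -- As `1/p ≥ 1`, this linearizes the block bound in `B l`, so that summing over `l` gives
    -- `S^(1/p)`.
    have hBpow : B l ^ (1 / p) ≤ B l * S ^ (1 / p - 1) := by
      calc B l ^ (1 / p) = B l ^ (1 + (1 / p - 1)) := by ring_nf
        _ = B l * B l ^ (1 / p - 1) := by
          rw [Real.rpow_add_of_nonneg (hB0 l) zero_le_one (by linarith), Real.rpow_one]
        _ ≤ _ := mul_le_mul_of_nonneg_left
          (Real.rpow_le_rpow (hB0 l) (hBS l) (by linarith)) (hB0 l)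
    refine le_trans ?_ (mul_le_mul_of_nonneg_left hBpow (Real.rpow_nonneg hkR.le _))
    -- Either block `l + 1` is empty, or block `l` is full. In the second case its leading entry `M`
    -- bounds block `l + 1` above and all `k` entries of block `l` below.
    rcases le_or_gt n ((l + 1) * k) with hn | hn
    · rw [Finset.sum_eq_zero, Real.sqrt_zero]
      · exact mul_nonneg (Real.rpow_nonneg hkR.le _) (Real.rpow_nonneg (hB0 l) _)
      · intro j hj
        rw [Finset.mem_filter, Finset.mem_range] at hj
        have := (Nat.le_div_iff_mul_le hk).1 hj.2.ge
        omega
    · set M := σ ((l + 1) * k) with hM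
      have hM0 : 0 ≤ M := hσ0 _
      have hcard : ∀ l, ((Finset.range n).filter (fun j => j / k = l)).card ≤ k := by
        intro l
        have : (Finset.range n).filter (fun j => j / k = l) ⊆ Finset.Ico (l * k) (l * k + k) := by
          intro j hj
          have hj' := (Finset.mem_filter.1 hj).2
          rw [Finset.mem_Ico]
          exact ⟨(Nat.le_div_iff_mul_le hk).1 hj'.ge, by
            have := (Nat.div_lt_iff_lt_mul hk (x := j) (y := l + 1)).1 (by omega)
            rwa [Nat.succ_mul] at this⟩
        simpa using Finset.card_le_card this
      have h1 : ∑ j ∈ (Finset.range n).filter (fun j => j / k = l + 1), σ j ^ 2 ≤ k * M ^ 2 := by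
        calc _ ≤ ∑ j ∈ (Finset.range n).filter (fun j => j / k = l + 1), M ^ 2 := by
              refine Finset.sum_le_sum fun j hj => pow_le_pow_left₀ (hσ0 j) (hσ ?_) 2
              exact (Nat.le_div_iff_mul_le hk).1 (Finset.mem_filter.1 hj).2.ge
          _ ≤ k * M ^ 2 := by
              rw [Finset.sum_const, nsmul_eq_mul]
              exact mul_le_mul_of_nonneg_right (by exact_mod_cast hcard (l + 1)) (sq_nonneg _)
      have h2 : k * M ^ p ≤ B l := by
        have hsub : Finset.Ico (l * k) (l * k + k) ⊆
            (Finset.range n).filter (fun j => j / k = l) := by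
          intro j hj
          rw [Finset.mem_Ico] at hj
          rw [Finset.mem_filter, Finset.mem_range]
          rw [Nat.succ_mul] at hn
          refine ⟨by omega, ?_⟩
          rw [Nat.div_eq_iff hk]
          constructor <;> omega
        calc k * M ^ p = ∑ j ∈ Finset.Ico (l * k) (l * k + k), M ^ p := by simp
          _ ≤ ∑ j ∈ Finset.Ico (l * k) (l * k + k), σ j ^ p := by
              refine Finset.sum_le_sum fun j hj => Real.rpow_le_rpow hM0 (hσ ?_) hp0.le
              rw [Nat.succ_mul]
              exact (Finset.mem_Ico.1 hj).2.le
          _ ≤ B l := Finset.sum_le_sum_of_subset_of_nonneg hsub fun j _ _ => hpow j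
      calc √(∑ j ∈ (Finset.range n).filter (fun j => j / k = l + 1), σ j ^ 2)
          ≤ √(k * M ^ 2) := Real.sqrt_le_sqrt h1
        _ = (k : ℝ) ^ (1 / 2 - 1 / p) * (k * M ^ p) ^ (1 / p) := by
            rw [Real.sqrt_mul hkR.le, Real.sqrt_sq hM0, Real.mul_rpow hkR.le (hpow _),
              ← Real.rpow_mul hM0, mul_one_div_cancel hp0.ne', Real.rpow_one, ← mul_assoc,
              ← Real.rpow_add hkR, sub_add_cancel, Real.sqrt_eq_rpow]
        _ ≤ _ := mul_le_mul_of_nonneg_left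
            (Real.rpow_le_rpow (mul_nonneg hkR.le (hpow _)) h2 (by linarith))
            (Real.rpow_nonneg hkR.le _)
  have hS0 : 0 ≤ S := Finset.sum_nonneg fun j _ => hpow j
  calc _ ≤ ∑ l ∈ Finset.range n, (k : ℝ) ^ (1 / 2 - 1 / p) * (B l * S ^ (1 / p - 1)) :=
        Finset.sum_le_sum fun l _ => hblock l
    _ = (k : ℝ) ^ (1 / 2 - 1 / p) * (S * S ^ (1 / p - 1)) := by
        rw [← Finset.mul_sum, ← Finset.sum_mul, hsumB]
    _ = _ := by
        congr 1
        rw [← Real.rpow_one_add' hS0 (by linarith)]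
        ring_nf

end Blocks

/-! ### Splitting relative to the row and column spaces of a map. -/

section Decomposition

variable {E F : Type*} [NormedAddCommGroup E] [InnerProductSpace ℝ E] [FiniteDimensional ℝ E]
  [NormedAddCommGroup F] [InnerProductSpace ℝ F]

/-- Splitting of `g` relative to `f`: a part of rank at most `2 rank f`, and a part whose row and
column spaces are orthogonal to those of `f`. -/
theorem exists_decomposition [FiniteDimensional ℝ F] (f g : E →ₗ[ℝ] F) :
    ∃ g₁ g₂ : E →ₗ[ℝ] F, g = g₁ + g₂ ∧
      Module.finrank ℝ (LinearMap.range g₁) ≤ 2 * Module.finrank ℝ (LinearMap.range f) ∧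
      LinearMap.range f ⟂ LinearMap.range g₂ ∧ (LinearMap.ker f)ᗮ ⟂ (LinearMap.ker g₂)ᗮ ∧
      ∀ x ∈ LinearMap.range g₂, ∀ y ∈ (LinearMap.ker g₂)ᗮ, ⟪g₁ y, x⟫_ℝ = 0 := by
  set V := LinearMap.range f with hV
  set U := LinearMap.ker f with hU
  set P : F →ₗ[ℝ] F := V.starProjection.toLinearMap with hP
  set P' : F →ₗ[ℝ] F := Vᗮ.starProjection.toLinearMap with hP'
  set Q : E →ₗ[ℝ] E := U.starProjection.toLinearMap with hQ
  set Q' : E →ₗ[ℝ] E := Uᗮ.starProjection.toLinearMap with hQ'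
  have hPP : ∀ x, P x + P' x = x := fun x =>
    Submodule.starProjection_add_starProjection_orthogonal (K := V) x
  have hQQ : ∀ x, Q x + Q' x = x := fun x =>
    Submodule.starProjection_add_starProjection_orthogonal (K := U) x
  have hrange : LinearMap.range (P' ∘ₗ g ∘ₗ Q) ≤ Vᗮ := by
    rintro _ ⟨z, rfl⟩
    exact Submodule.starProjection_apply_mem Vᗮ _
  have hker : (LinearMap.ker (P' ∘ₗ g ∘ₗ Q))ᗮ ≤ U := by
    have : Uᗮ ≤ LinearMap.ker (P' ∘ₗ g ∘ₗ Q) := by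
      intro z hz
      have : Q z = 0 := (Submodule.starProjection_apply_eq_zero_iff U).2 hz
      simp [this]
    have h := Submodule.orthogonal_le this
    rwa [Submodule.orthogonal_orthogonal] at h
  -- The first term of `g₁` lands in `range f` and the second factors through `(ker f)ᗮ`, both of
  -- dimension `rank f`.
  refine ⟨P ∘ₗ g + P' ∘ₗ g ∘ₗ Q', P' ∘ₗ g ∘ₗ Q, ?_, ?_, ?_, ?_, ?_⟩
  · ext1 z
    simp only [LinearMap.add_apply, LinearMap.comp_apply]
    rw [add_assoc, ← map_add, ← map_add, add_comm (Q' z), hQQ, hPP]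
  · have h1 : Module.finrank ℝ (LinearMap.range (P ∘ₗ g)) ≤ Module.finrank ℝ V := by
      refine Submodule.finrank_mono ?_
      rintro _ ⟨z, rfl⟩
      exact Submodule.starProjection_apply_mem V _
    have h2 : Module.finrank ℝ (LinearMap.range (P' ∘ₗ g ∘ₗ Q')) ≤ Module.finrank ℝ V := by
      have hQr : LinearMap.range Q' ≤ Uᗮ := by
        rintro _ ⟨z, rfl⟩
        exact Submodule.starProjection_apply_mem Uᗮ _
      have h3 : Module.finrank ℝ (LinearMap.range (P' ∘ₗ g ∘ₗ Q'))
          ≤ Module.finrank ℝ (LinearMap.range Q') := by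
        rw [← LinearMap.comp_assoc, LinearMap.range_comp]
        exact Submodule.finrank_map_le _ _
      have h4 := Submodule.finrank_mono hQr
      have h5 := LinearMap.finrank_range_add_finrank_ker f
      rw [← hV, ← hU] at h5
      have h6 := Submodule.finrank_add_finrank_orthogonal U
      omega
    have h3 := (Submodule.finrank_mono (LinearMap.range_add_le (P ∘ₗ g) (P' ∘ₗ g ∘ₗ Q'))).trans
      (Submodule.finrank_add_le_finrank_add_finrank _ _)
    omega
  · exact (Submodule.isOrtho_orthogonal_right V).mono_right hrange
  · exact (Submodule.isOrtho_orthogonal_left U).mono_right hker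
  -- The row space of `g₂` lies in `ker f`, where `Q'` vanishes; so `g₁ y` lies in `range f`,
  -- orthogonal to `range g₂`.
  · intro x hx y hy
    have h1 : Q' y = 0 := (Submodule.starProjection_apply_eq_zero_iff Uᗮ).2 (by
      rw [Submodule.orthogonal_orthogonal]; exact hker hy)
    simp only [LinearMap.add_apply, LinearMap.comp_apply, h1, map_zero, add_zero]
    exact Submodule.inner_right_of_mem_orthogonal (Submodule.starProjection_apply_mem V _)
      (hrange hx)

end Decomposition

/-! ### Deterministic error bounds from restricted isometry. -/

section ErrorBounds

variable {E F G : Type*} [NormedAddCommGroup E] [InnerProductSpace ℝ E] [FiniteDimensional ℝ E]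
  [NormedAddCommGroup F] [InnerProductSpace ℝ F] [FiniteDimensional ℝ F]
  [NormedAddCommGroup G] [NormedSpace ℝ G]

/-- Splitting along the decreasing singular values into blocks of rank at most `k`. -/
theorem exists_block_decomposition (g : E →ₗ[ℝ] F) {k : ℕ} (hk : 0 < k) {p : ℝ} (hp0 : 0 < p)
    (hp1 : p ≤ 1) :
    ∃ (n : ℕ) (h : ℕ → E →ₗ[ℝ] F), g = h 0 + ∑ l ∈ Finset.range n, h (l + 1) ∧
      (∀ l, Module.finrank ℝ (LinearMap.range (h l)) ≤ k) ∧
      ∑ l ∈ Finset.range n, ‖hsVec (h (l + 1))‖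
        ≤ (k : ℝ) ^ (1 / 2 - 1 / p) * schattenSum p g ^ (1 / p) ∧
      ∀ g' : E →ₗ[ℝ] F,
        (∀ x ∈ LinearMap.range g, ∀ y ∈ (LinearMap.ker g)ᗮ, ⟪g' y, x⟫_ℝ = 0) →
        ∀ l, ⟪hsVec g', hsVec (h l)⟫_ℝ = 0 := by
  obtain ⟨u, v, hg⟩ := exists_isSVD g
  let n := Module.finrank ℝ (LinearMap.range g)
  set J : ℕ → Finset (Fin n) := fun l => Finset.univ.filter fun j => (j : ℕ) / k = l with hJ
  set h : ℕ → E →ₗ[ℝ] F := fun l => ∑ j ∈ J l, g.singularValues j • atom (u j) (v j) with hh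
  have hcard : ∀ l, (J l).card ≤ k := by
    intro l
    have hsub : (J l).map Fin.valEmbedding ⊆ Finset.Ico (l * k) (l * k + k) := by
      intro i hi
      obtain ⟨j, hj, rfl⟩ := Finset.mem_map.1 hi
      have hj' : (j : ℕ) / k = l := (Finset.mem_filter.1 hj).2
      rw [Nat.div_eq_iff hk] at hj'
      rw [Finset.mem_Ico, Fin.valEmbedding_apply]
      omega
    simpa using Finset.card_le_card hsub
  -- Blocks `0` to `n` exhaust the indices because `j / k ≤ j < n`; the superfluous ones are empty.
  refine ⟨n, h, ?_, fun l => (finrank_range_sum_atom_le _ _ _ _).trans (hcard l), ?_, ?_⟩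
  · rw [← add_comm, ← Finset.sum_range_succ' h n]
    conv_lhs => rw [hg.eq_sum]
    refine (Finset.sum_fiberwise_of_maps_to (g := fun j : Fin n => (j : ℕ) / k)
      (fun j _ => ?_) _).symm
    exact Finset.mem_range.2 ((Nat.div_le_self _ _).trans_lt (j.2.trans (Nat.lt_succ_self n)))
  · have hnorm : ∀ l, ‖hsVec (h l)‖
        = √(∑ j ∈ (Finset.range n).filter (fun j => j / k = l), g.singularValues j ^ 2) := by
      intro l
      rw [Finset.sum_filter, Finset.sum_range, ← Finset.sum_filter, ← hg.norm_hsVec_sum_sq (J l),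
        Real.sqrt_sq (norm_nonneg _)]
    simp_rw [hnorm]
    exact sum_sqrt_block_le g.singularValues_antitone g.singularValues_nonneg n hk hp0 hp1
  · intro g' hg' l
    simp only [hh, map_sum, map_smul, inner_sum, inner_smul_right, inner_hsVec_atom]
    refine Finset.sum_eq_zero fun j _ => ?_
    rw [hg' _ (hg.left_mem_range j) _ (hg.right_mem_ker_orthogonal j), mul_zero]

/-- A restricted isometry controls the Hilbert-Schmidt norm on the cone of maps whose part
orthogonal to a given low rank map is dominated by the low rank part. -/
theorem norm_hsVec_le_of_restricted_isometry (L : (E →ₗ[ℝ] F) →ₗ[ℝ] G) {a r : ℕ} (ha : 0 < a)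
    (hr : 0 < r) {ν δ p K : ℝ} (hδ : δ ≤ 1 / 4) (hp0 : 0 < p) (hp1 : p ≤ 1)
    (hK0 : 0 ≤ K) (hK : K ^ (1 / p) * (2 / (a : ℝ)) ^ (1 / p - 1 / 2) ≤ 1 / 4)
    (hL : ∀ f : E →ₗ[ℝ] F, Module.finrank ℝ (LinearMap.range f) ≤ (2 + a) * r →
      (1 - δ) * ‖hsVec f‖ ≤ ν * ‖L f‖ ∧ ν * ‖L f‖ ≤ (1 + δ) * ‖hsVec f‖)
    (hν : 0 < ν) {g₁ g₂ : E →ₗ[ℝ] F} (hg₁ : Module.finrank ℝ (LinearMap.range g₁) ≤ 2 * r)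
    (horth : ∀ x ∈ LinearMap.range g₂, ∀ y ∈ (LinearMap.ker g₂)ᗮ, ⟪g₁ y, x⟫_ℝ = 0)
    (hcone : schattenSum p g₂ ≤ K * schattenSum p g₁) :
    ‖hsVec g₁‖ ≤ 3 * ν * ‖L (g₁ + g₂)‖ ∧ ‖hsVec (g₁ + g₂)‖ ≤ 4 * ν * ‖L (g₁ + g₂)‖ := by
  obtain ⟨n, h, hsum, hrank, htail, hinner⟩ :=
    exists_block_decomposition g₂ (Nat.mul_pos ha hr) hp0 hp1
  have haR : (0 : ℝ) < a := by exact_mod_cast ha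
  have hrR : (0 : ℝ) < r := by exact_mod_cast hr
  set R : E →ₗ[ℝ] F := ∑ l ∈ Finset.range n, h (l + 1) with hR
  have hp' : 0 < 1 / p := by positivity
  have htail' : ∑ l ∈ Finset.range n, ‖hsVec (h (l + 1))‖ ≤ 1 / 4 * ‖hsVec g₁‖ := by
    have h1 : schattenSum p g₂ ≤ K * (((2 * r : ℕ) : ℝ) ^ (1 - p / 2) * ‖hsVec g₁‖ ^ p) :=
      hcone.trans (mul_le_mul_of_nonneg_left (schattenSum_le_rank_rpow_mul g₁ hp0 hp1 hg₁) hK0)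
    have h2 := Real.rpow_le_rpow (schattenSum_nonneg p g₂) h1 hp'.le
    rw [Real.mul_rpow hK0 (by positivity), Real.mul_rpow (by positivity) (by positivity),
      ← Real.rpow_mul (norm_nonneg _), ← Real.rpow_mul (by positivity), mul_one_div_cancel hp0.ne',
      Real.rpow_one] at h2
    -- The rank `r` cancels between block length `ar` and rank bound `2r`, leaving a power of `2/a`
    -- that `hK` makes small.
    have h3 : (((a * r : ℕ) : ℝ)) ^ (1 / 2 - 1 / p) * ((2 * r : ℕ) : ℝ) ^ ((1 - p / 2) * (1 / p))
        = (2 / (a : ℝ)) ^ (1 / p - 1 / 2) := by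
      have e1 : (1 - p / 2) * (1 / p) = 1 / p - 1 / 2 := by field_simp
      have e2 : (2 / (a : ℝ)) = ((2 * r : ℕ) : ℝ) / ((a * r : ℕ) : ℝ) := by
        push_cast; field_simp
      rw [e1, e2, Real.div_rpow (by positivity) (by positivity),
        show (1 / 2 - 1 / p : ℝ) = -(1 / p - 1 / 2) by ring, Real.rpow_neg (by positivity)]
      ring
    refine htail.trans ((mul_le_mul_of_nonneg_left h2 (by positivity)).trans ?_)
    calc (((a * r : ℕ) : ℝ)) ^ (1 / 2 - 1 / p) * (K ^ (1 / p) *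
          (((2 * r : ℕ) : ℝ) ^ ((1 - p / 2) * (1 / p)) * ‖hsVec g₁‖))
        = K ^ (1 / p) * ((((a * r : ℕ) : ℝ)) ^ (1 / 2 - 1 / p) *
          ((2 * r : ℕ) : ℝ) ^ ((1 - p / 2) * (1 / p))) * ‖hsVec g₁‖ := by ring
      _ ≤ 1 / 4 * ‖hsVec g₁‖ := by
        rw [h3]; exact mul_le_mul_of_nonneg_right hK (norm_nonneg _)
  have hgsum : g₁ + g₂ = (g₁ + h 0) + R := by rw [hsum, add_assoc]
  have hrank0 : Module.finrank ℝ (LinearMap.range (g₁ + h 0)) ≤ (2 + a) * r := by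
    have h1 := (Submodule.finrank_mono (LinearMap.range_add_le g₁ (h 0))).trans
      (Submodule.finrank_add_le_finrank_add_finrank _ _)
    have h2 := hrank 0
    rw [add_mul]
    omega
  -- `h 0` is Hilbert-Schmidt orthogonal to `g₁`, so adding it cannot shrink the norm.
  have hhead : ‖hsVec g₁‖ ≤ ‖hsVec (g₁ + h 0)‖ := by
    have h1 := norm_add_sq_real (hsVec g₁) (hsVec (h 0))
    rw [hinner g₁ horth 0, ← map_add] at h1
    refine le_of_sq_le_sq ?_ (norm_nonneg _)
    nlinarith [sq_nonneg ‖hsVec (h 0)‖]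
  have hRhs : ‖hsVec R‖ ≤ 1 / 4 * ‖hsVec g₁‖ := by
    rw [hR, map_sum]
    exact (norm_sum_le _ _).trans htail'
  have hRL : ν * ‖L R‖ ≤ 5 / 16 * ‖hsVec g₁‖ := by
    calc ν * ‖L R‖ ≤ ν * ∑ l ∈ Finset.range n, ‖L (h (l + 1))‖ := by
          rw [hR, map_sum]
          exact mul_le_mul_of_nonneg_left (norm_sum_le _ _) hν.le
      _ ≤ ∑ l ∈ Finset.range n, 5 / 4 * ‖hsVec (h (l + 1))‖ := by
          rw [Finset.mul_sum]
          refine Finset.sum_le_sum fun l _ => ?_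
          refine ((hL _ ((hrank _).trans (Nat.mul_le_mul_right r (by omega)))).2).trans ?_
          exact mul_le_mul_of_nonneg_right (by linarith) (norm_nonneg _)
      _ ≤ 5 / 16 * ‖hsVec g₁‖ := by
          rw [← Finset.mul_sum]
          linarith
  have hmain : 3 / 4 * ‖hsVec (g₁ + h 0)‖ ≤ ν * ‖L (g₁ + g₂)‖ + 5 / 16 * ‖hsVec g₁‖ := by
    have h1 := (hL _ hrank0).1
    have h2 : ‖L (g₁ + h 0)‖ ≤ ‖L (g₁ + g₂)‖ + ‖L R‖ := by
      rw [hgsum, map_add L _ R]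
      have := norm_sub_le (L (g₁ + h 0) + L R) (L R)
      rwa [add_sub_cancel_right] at this
    have h3 := mul_le_mul_of_nonneg_left h2 hν.le
    have h4 : 3 / 4 * ‖hsVec (g₁ + h 0)‖ ≤ (1 - δ) * ‖hsVec (g₁ + h 0)‖ :=
      mul_le_mul_of_nonneg_right (by linarith) (norm_nonneg _)
    linarith
  have hnn : 0 ≤ ν * ‖L (g₁ + g₂)‖ := mul_nonneg hν.le (norm_nonneg _)
  -- With `hhead`, `hmain` gives `(3/4 - 5/16) ‖g₁ + h 0‖ ≤ ν ‖L (g₁ + g₂)‖`, that is, constant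
  -- `16/7 ≤ 3`; adding the tail gives `(5/4)(16/7) ≤ 4`.
  have hfirst : ‖hsVec g₁‖ ≤ 3 * ν * ‖L (g₁ + g₂)‖ := by linarith
  refine ⟨hfirst, ?_⟩
  have hfin : ‖hsVec (g₁ + g₂)‖ ≤ ‖hsVec (g₁ + h 0)‖ + ‖hsVec R‖ := by
    rw [hgsum, map_add hsVec _ R]
    exact norm_add_le _ _
  linarith

/-- Interpolation of Schatten sums between the exponents `p` and `2`. -/
theorem schattenSum_le_interpolation (f : E →ₗ[ℝ] F) {p q x : ℝ} (hx : 0 < x) (hpq : p ≤ q)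
    (hq2 : q ≤ 2) :
    schattenSum q f ≤ x ^ (q - p) * schattenSum p f + x ^ (q - 2) * schattenSum 2 f := by
  unfold schattenSum
  rw [Finset.mul_sum, Finset.mul_sum, ← Finset.sum_add_distrib]
  refine Finset.sum_le_sum fun j hj => ?_
  have hσ : 0 < f.singularValues j :=
    f.singularValues_pos_iff_lt_finrank_range.2 (Finset.mem_range.1 hj)
  set σ := f.singularValues j
  -- Singular values below `x` are absorbed by the `p` term, those above by the square term.
  rcases le_total σ x with h | h
  · have h1 : σ ^ q = σ ^ (q - p) * σ ^ p := by rw [← Real.rpow_add hσ]; ring_nf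
    have h2 : σ ^ (q - p) ≤ x ^ (q - p) := Real.rpow_le_rpow hσ.le h (by linarith)
    have h3 := mul_le_mul_of_nonneg_right h2 (Real.rpow_nonneg hσ.le p)
    have h4 : 0 ≤ x ^ (q - 2) * σ ^ (2 : ℝ) := by positivity
    linarith
  · have h1 : σ ^ q = σ ^ (q - 2) * σ ^ (2 : ℝ) := by rw [← Real.rpow_add hσ]; ring_nf
    have h2 : σ ^ (q - 2) ≤ x ^ (q - 2) := Real.rpow_le_rpow_of_nonpos hx h (by linarith)
    have h3 := mul_le_mul_of_nonneg_right h2 (Real.rpow_nonneg hσ.le 2)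
    have h4 : 0 ≤ x ^ (q - p) * σ ^ p := by positivity
    linarith

/-- Solution of the scalar inequality `d² ≤ Z dᵖ`. -/
theorem sq_le_rpow_of_sq_le_mul_rpow {d Z p : ℝ} (hd : 0 ≤ d) (hZ : 0 ≤ Z)
    (hp1 : p ≤ 1) (h : d ^ 2 ≤ Z * d ^ p) : d ^ 2 ≤ Z ^ (2 / (2 - p)) := by
  rcases hd.eq_or_lt with rfl | hd
  · simpa using Real.rpow_nonneg hZ _
  have h1 : d ^ (2 - p) ≤ Z := by
    rw [Real.rpow_sub hd, div_le_iff₀ (Real.rpow_pos_of_pos hd p)]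
    simpa using h
  have h2 := Real.rpow_le_rpow (Real.rpow_nonneg hd.le _) h1
    (show 0 ≤ 2 / (2 - p) from div_nonneg two_pos.le (by linarith))
  rwa [← Real.rpow_mul hd.le, mul_div_cancel₀ _ (by linarith : (2 - p : ℝ) ≠ 0),
    Real.rpow_two] at h2

/-- The low rank part of a map satisfying the cone conditions obeys the oracle rate. -/
theorem error_bounds_of_cone {d S₁ H ν τ p : ℝ} {r : ℕ} (hr : 0 < r) (hd : 0 ≤ d)
    (hH : 0 ≤ H) (hν : 0 < ν) (hτ : 0 < τ) (hp0 : 0 < p) (hp1 : p ≤ 1)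
    (hpred : d ^ 2 ≤ 16 * τ * S₁) (hS : S₁ ≤ ((2 * r : ℕ) : ℝ) ^ (1 - p / 2) * H ^ p)
    (hHd : H ≤ 3 * ν * d) :
    d ^ 2 ≤ 96 ^ (2 / (2 - p)) * r * τ ^ (2 / (2 - p)) * ν ^ (2 * p / (2 - p)) ∧
      S₁ ≤ 6 * 96 ^ (2 / (2 - p)) * r * τ ^ (p / (2 - p)) * ν ^ (2 * p / (2 - p)) := by
  have hrR : (0 : ℝ) < r := by exact_mod_cast hr
  have h2p : (0 : ℝ) < 2 - p := by linarith
  -- Here `6 = 2 · 3` bounds `2^(1-p/2) · 3^p`; below, `96 = 16 · 6`.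
  have hS' : S₁ ≤ 6 * (r : ℝ) ^ (1 - p / 2) * ν ^ p * d ^ p := by
    have h1 : H ^ p ≤ 3 * (ν ^ p * d ^ p) := by
      refine (Real.rpow_le_rpow hH hHd hp0.le).trans ?_
      rw [Real.mul_rpow (by positivity) hd, Real.mul_rpow (by norm_num) hν.le, mul_assoc]
      refine mul_le_mul_of_nonneg_right ?_ (by positivity)
      calc (3 : ℝ) ^ p ≤ 3 ^ (1 : ℝ) := Real.rpow_le_rpow_of_exponent_le (by norm_num) hp1
        _ = 3 := Real.rpow_one 3
    have h2 : ((2 * r : ℕ) : ℝ) ^ (1 - p / 2) ≤ 2 * (r : ℝ) ^ (1 - p / 2) := by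
      push_cast
      rw [Real.mul_rpow (by norm_num) hrR.le]
      refine mul_le_mul_of_nonneg_right ?_ (by positivity)
      calc (2 : ℝ) ^ (1 - p / 2) ≤ 2 ^ (1 : ℝ) :=
            Real.rpow_le_rpow_of_exponent_le (by norm_num) (by linarith)
        _ = 2 := Real.rpow_one 2
    calc S₁ ≤ _ := hS
      _ ≤ (2 * (r : ℝ) ^ (1 - p / 2)) * (3 * (ν ^ p * d ^ p)) :=
          mul_le_mul h2 h1 (by positivity) (by positivity)
      _ = _ := by ring
  have hd2 : d ^ 2 ≤ 96 ^ (2 / (2 - p)) * r * τ ^ (2 / (2 - p)) * ν ^ (2 * p / (2 - p)) := by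
    have h1 : d ^ 2 ≤ (96 * τ * (r : ℝ) ^ (1 - p / 2) * ν ^ p) * d ^ p := by
      have := mul_le_mul_of_nonneg_left hS' (by positivity : 0 ≤ 16 * τ)
      nlinarith
    refine (sq_le_rpow_of_sq_le_mul_rpow hd (by positivity) hp1 h1).trans_eq ?_
    rw [Real.mul_rpow (by positivity) (by positivity), Real.mul_rpow (by positivity) (by positivity),
      Real.mul_rpow (by positivity) (by positivity), ← Real.rpow_mul hrR.le, ← Real.rpow_mul hν.le]
    have e1 : (1 - p / 2) * (2 / (2 - p)) = 1 := by field_simp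
    have e2 : p * (2 / (2 - p)) = 2 * p / (2 - p) := by ring
    rw [e1, e2, Real.rpow_one]
    ring
  refine ⟨hd2, ?_⟩
  have hdp : d ^ p ≤ 96 ^ (2 / (2 - p)) *
      ((r : ℝ) ^ (p / 2) * τ ^ (p / (2 - p)) * ν ^ (p * p / (2 - p))) := by
    have h1 := Real.rpow_le_rpow (sq_nonneg d) hd2 (by positivity : 0 ≤ p / 2)
    have e0 : (d ^ 2) ^ (p / 2) = d ^ p := by
      rw [← Real.rpow_two, ← Real.rpow_mul hd]
      ring_nf
    rw [e0, Real.mul_rpow (by positivity) (by positivity),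
      Real.mul_rpow (by positivity) (by positivity), Real.mul_rpow (by positivity) (by positivity),
      ← Real.rpow_mul hτ.le, ← Real.rpow_mul hν.le] at h1
    have e1 : 2 / (2 - p) * (p / 2) = p / (2 - p) := by field_simp
    have e2 : 2 * p / (2 - p) * (p / 2) = p * p / (2 - p) := by field_simp
    rw [e1, e2] at h1
    -- The constant exceeds one, so its power `p/2` is replaced by itself.
    have hC : (1 : ℝ) ≤ 96 ^ (2 / (2 - p)) :=
      Real.one_le_rpow (by norm_num) (div_nonneg two_pos.le h2p.le)
    have h2 : ((96 : ℝ) ^ (2 / (2 - p))) ^ (p / 2) ≤ 96 ^ (2 / (2 - p)) := by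
      calc _ ≤ ((96 : ℝ) ^ (2 / (2 - p))) ^ (1 : ℝ) :=
            Real.rpow_le_rpow_of_exponent_le hC (by linarith)
        _ = _ := Real.rpow_one _
    have h3 := mul_le_mul_of_nonneg_right h2 (by positivity :
      0 ≤ (r : ℝ) ^ (p / 2) * τ ^ (p / (2 - p)) * ν ^ (p * p / (2 - p)))
    linarith
  have er : (r : ℝ) = (r : ℝ) ^ (1 - p / 2) * (r : ℝ) ^ (p / 2) := by
    rw [← Real.rpow_add hrR, sub_add_cancel, Real.rpow_one]
  have eν : ν ^ (2 * p / (2 - p)) = ν ^ p * ν ^ (p * p / (2 - p)) := by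
    rw [← Real.rpow_add hν]
    congr 1
    field_simp
    ring
  calc S₁ ≤ 6 * (r : ℝ) ^ (1 - p / 2) * ν ^ p * d ^ p := hS'
    _ ≤ 6 * (r : ℝ) ^ (1 - p / 2) * ν ^ p * (96 ^ (2 / (2 - p)) *
      ((r : ℝ) ^ (p / 2) * τ ^ (p / (2 - p)) * ν ^ (p * p / (2 - p)))) :=
        mul_le_mul_of_nonneg_left hdp (by positivity)
    _ = 6 * 96 ^ (2 / (2 - p)) * ((r : ℝ) ^ (1 - p / 2) * (r : ℝ) ^ (p / 2)) * τ ^ (p / (2 - p)) *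
        (ν ^ p * ν ^ (p * p / (2 - p))) := by ring
    _ = _ := by rw [← er, ← eν]

/-- Deterministic error bounds implied by the basic inequality and a restricted isometry. -/
theorem error_bounds_of_basic_inequality (L : (E →ₗ[ℝ] F) →ₗ[ℝ] G) {a r : ℕ} (ha : 0 < a)
    (hr : 0 < r) {ν δ τ p θ : ℝ} (hδ : δ ≤ 1 / 4) (hp0 : 0 < p) (hp1 : p ≤ 1) (hθ0 : 0 ≤ θ)
    (hθ1 : θ < 1)
    (hK : ((1 + θ) / (1 - θ)) ^ (1 / p) * (2 / (a : ℝ)) ^ (1 / p - 1 / 2) ≤ 1 / 4)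
    (hL : ∀ f : E →ₗ[ℝ] F, Module.finrank ℝ (LinearMap.range f) ≤ (2 + a) * r →
      (1 - δ) * ‖hsVec f‖ ≤ ν * ‖L f‖ ∧ ν * ‖L f‖ ≤ (1 + δ) * ‖hsVec f‖)
    (hν : 0 < ν) (hτ : 0 < τ) {f g : E →ₗ[ℝ] F}
    (hf : Module.finrank ℝ (LinearMap.range f) ≤ r)
    (hbasic : ‖L g‖ ^ 2
      ≤ 8 * τ * (θ * schattenSum p g + schattenSum p f - schattenSum p (f + g))) :
    ‖L g‖ ^ 2 ≤ 96 ^ (2 / (2 - p)) * r * τ ^ (2 / (2 - p)) * ν ^ (2 * p / (2 - p)) ∧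
      ∀ q ∈ Set.Icc p 2, schattenSum q g ≤
        (96 ^ (2 / (2 - p)) * (6 * (1 + (1 + θ) / (1 - θ)) + 16)) * r * τ ^ (q / (2 - p)) *
          ν ^ (2 * q / (2 - p)) := by
  obtain ⟨g₁, g₂, hg, hrank, hrange, hker, horth⟩ := exists_decomposition f g
  set K := (1 + θ) / (1 - θ) with hKdef
  have hθ : 0 < 1 - θ := by linarith
  have hK0 : 0 ≤ K := div_nonneg (by linarith) hθ.le
  have hadd := schattenSum_add_of_orthogonal f g₂ hp0 hp1 hrange hker
  have htri := schattenSum_add_le g₁ g₂ hp0 hp1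
  -- The triangle inequality for `f + g₂ = (f + g) + (-g₁)`.
  have htri' : schattenSum p (f + g₂) ≤ schattenSum p (f + g) + schattenSum p g₁ := by
    have h1 := schattenSum_add_le (f + g) (-g₁) hp0 hp1
    rw [schattenSum_neg g₁ hp0 hp1] at h1
    have h2 : f + g + -g₁ = f + g₂ := by rw [hg]; abel
    rwa [h2] at h1
  rw [← hg] at htri
  have hS1 := schattenSum_nonneg p g₁
  have hS2 := schattenSum_nonneg p g₂
  have hmain : ‖L g‖ ^ 2
      ≤ 8 * τ * ((1 + θ) * schattenSum p g₁ - (1 - θ) * schattenSum p g₂) := by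
    refine hbasic.trans (mul_le_mul_of_nonneg_left ?_ (by positivity))
    nlinarith [mul_le_mul_of_nonneg_left htri hθ0]
  have hcone : schattenSum p g₂ ≤ K * schattenSum p g₁ := by
    have h1 : 0 ≤ (1 + θ) * schattenSum p g₁ - (1 - θ) * schattenSum p g₂ := by
      have h2 := (sq_nonneg ‖L g‖).trans hmain
      exact nonneg_of_mul_nonneg_right h2 (by positivity)
    rw [hKdef, div_mul_eq_mul_div, le_div_iff₀ hθ]
    linarith
  have hpred : ‖L g‖ ^ 2 ≤ 16 * τ * schattenSum p g₁ := by
    refine hmain.trans ?_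
    have h1 : (1 + θ) * schattenSum p g₁ - (1 - θ) * schattenSum p g₂ ≤ 2 * schattenSum p g₁ := by
      nlinarith [mul_nonneg hθ.le hS2, mul_nonneg hθ.le hS1]
    have := mul_le_mul_of_nonneg_left h1 (by positivity : 0 ≤ 8 * τ)
    linarith
  have hrank₁ : Module.finrank ℝ (LinearMap.range g₁) ≤ 2 * r := by omega
  obtain ⟨hH1, hH⟩ := norm_hsVec_le_of_restricted_isometry L ha hr hδ hp0 hp1 hK0 hK hL hν hrank₁
    horth hcone
  rw [← hg] at hH1 hH
  obtain ⟨hd, hSp⟩ := error_bounds_of_cone hr (norm_nonneg (L g)) (norm_nonneg (hsVec g₁)) hν hτ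
    hp0 hp1 hpred (schattenSum_le_rank_rpow_mul g₁ hp0 hp1 hrank₁) hH1
  refine ⟨hd, fun q hq => ?_⟩
  have h2p : (0 : ℝ) < 2 - p := by linarith
  set C : ℝ := 96 ^ (2 / (2 - p)) with hC
  -- The scale at which the bounds for exponents `p` and `2` read `r x^p` and `r x²` up to
  -- constants; interpolating at it gives `r x^q` with a constant free of `q`.
  set x : ℝ := τ ^ (1 / (2 - p)) * ν ^ (2 / (2 - p)) with hx
  have hx0 : 0 < x := by positivity
  have hxpow : ∀ s : ℝ, x ^ s = τ ^ (s / (2 - p)) * ν ^ (2 * s / (2 - p)) := by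
    intro s
    rw [hx, Real.mul_rpow (by positivity) (by positivity), ← Real.rpow_mul hτ.le,
      ← Real.rpow_mul hν.le]
    ring_nf
  have hp_bound : schattenSum p g ≤ 6 * (1 + K) * C * r * x ^ p := by
    rw [hxpow p]
    have h1 := mul_le_mul_of_nonneg_left hSp (by linarith : 0 ≤ 1 + K)
    nlinarith
  have h2_bound : schattenSum 2 g ≤ 16 * C * r * x ^ (2 : ℝ) := by
    rw [schattenSum_two, hxpow 2]
    have h1 : ‖hsVec g‖ ^ 2 ≤ 16 * ν ^ 2 * ‖L g‖ ^ 2 := by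
      have := pow_le_pow_left₀ (norm_nonneg _) hH 2
      linarith [this, (by ring : (4 * ν * ‖L g‖) ^ 2 = 16 * ν ^ 2 * ‖L g‖ ^ 2)]
    have h3 : ν ^ (2 * 2 / (2 - p)) = ν ^ 2 * ν ^ (2 * p / (2 - p)) := by
      rw [← Real.rpow_two, ← Real.rpow_add hν]
      congr 1
      field_simp
      ring
    have h4 := mul_le_mul_of_nonneg_left hd (by positivity : 0 ≤ 16 * ν ^ 2)
    rw [h3]
    linarith
  have hint := schattenSum_le_interpolation g hx0 hq.1 hq.2
  have e1 : x ^ (q - p) * x ^ p = x ^ q := by rw [← Real.rpow_add hx0, sub_add_cancel]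
  have e2 : x ^ (q - 2) * x ^ (2 : ℝ) = x ^ q := by rw [← Real.rpow_add hx0, sub_add_cancel]
  calc schattenSum q g ≤ _ := hint
    _ ≤ x ^ (q - p) * (6 * (1 + K) * C * r * x ^ p) + x ^ (q - 2) * (16 * C * r * x ^ (2 : ℝ)) :=
        add_le_add (mul_le_mul_of_nonneg_left hp_bound (by positivity))
          (mul_le_mul_of_nonneg_left h2_bound (by positivity))
    _ = 6 * (1 + K) * C * r * (x ^ (q - p) * x ^ p) + 16 * C * r * (x ^ (q - 2) * x ^ (2 : ℝ)) := by
        ring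
    _ = (C * (6 * (1 + K) + 16)) * r * x ^ q := by rw [e1, e2]; ring
    _ = _ := by rw [hxpow q]; ring

end ErrorBounds

/-! ### Transfer to matrices and the estimator. -/

section Matrices

variable {m T N : ℕ}

theorem finrank_range_toEuclideanLin (A : Matrix (Fin m) (Fin T) ℝ) :
    Module.finrank ℝ (LinearMap.range (Matrix.toEuclideanLin A)) = A.rank := by
  rw [Matrix.toEuclideanLin, Matrix.toLpLin_eq_toLin]
  exact (A.rank_eq_finrank_range_toLin _ _).symm

/-- Indices from the rank up to `min m T` carry zero singular values, whose `q`-th powers vanish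
since `q > 0`. -/
theorem schattenNorm_rpow {q : ℝ} (hq : 0 < q) (A : Matrix (Fin m) (Fin T) ℝ) :
    schattenNorm q A ^ q = schattenSum q (Matrix.toEuclideanLin A) := by
  have hnn : 0 ≤ ∑ j ∈ Finset.range (min m T), singularValue A j ^ q :=
    Finset.sum_nonneg fun j _ => Real.rpow_nonneg (LinearMap.singularValues_nonneg _ j) q
  rw [schattenNorm, ← Real.rpow_mul hnn, one_div_mul_cancel hq.ne', Real.rpow_one, schattenSum,
    finrank_range_toEuclideanLin]
  refine (Finset.sum_subset (Finset.range_mono (le_min ?_ ?_)) fun j _ hj => ?_).symm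
  · simpa using A.rank_le_card_height
  · simpa using A.rank_le_card_width
  · rw [singularValue, (LinearMap.singularValues_eq_zero_iff_le_finrank_range _).2,
      Real.zero_rpow hq.ne']
    rw [finrank_range_toEuclideanLin]
    simpa using hj

theorem schattenNorm_two (A : Matrix (Fin m) (Fin T) ℝ) :
    schattenNorm 2 A = ‖hsVec (Matrix.toEuclideanLin A)‖ := by
  have h := schattenNorm_rpow two_pos A
  have hnn : 0 ≤ schattenNorm 2 A := Real.rpow_nonneg
    (Finset.sum_nonneg fun j _ => Real.rpow_nonneg (LinearMap.singularValues_nonneg _ j) 2) _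
  rw [schattenSum_two, Real.rpow_two] at h
  exact (pow_left_inj₀ hnn (norm_nonneg _) two_ne_zero).1 h

/-- The sampling operator as a linear map. -/
noncomputable def samplingLin (X : Fin N → Matrix (Fin m) (Fin T) ℝ) :
    Matrix (Fin m) (Fin T) ℝ →ₗ[ℝ] EuclideanSpace ℝ (Fin N) where
  toFun := sampling X
  map_add' A B := by
    ext i
    simp [sampling, Matrix.mul_add, add_div]
  map_smul' c A := by
    ext i
    simp [sampling, mul_div_assoc]

theorem predDist_sq (X : Fin N → Matrix (Fin m) (Fin T) ℝ) (A B : Matrix (Fin m) (Fin T) ℝ) :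
    predDist X A B ^ 2 = (1 / (N : ℝ)) * ∑ i, ((X i).transpose * (A - B)).trace ^ 2 := by
  rw [predDist, EuclideanSpace.norm_sq_eq, Finset.mul_sum]
  refine Finset.sum_congr rfl fun i _ => ?_
  simp only [sampling]
  rw [Real.norm_eq_abs, sq_abs, div_pow, Real.sq_sqrt (Nat.cast_nonneg N)]
  ring

/-- The basic inequality for a Schatten estimator. -/
theorem predDist_sq_le_of_isSchattenEstimator {X : Fin N → Matrix (Fin m) (Fin T) ℝ}
    {Y ξ : Fin N → ℝ} {Ahat Astar : Matrix (Fin m) (Fin T) ℝ}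
    (hY : ∀ i, Y i = ((X i).transpose * Astar).trace + ξ i) {p lam : ℝ}
    (h : IsSchattenEstimator X Y p lam Ahat) :
    predDist X Ahat Astar ^ 2
      ≤ 2 * ((1 / (N : ℝ)) * ∑ i, ξ i * ((X i).transpose * (Ahat - Astar)).trace)
        + lam * (schattenNorm p Astar ^ p - schattenNorm p Ahat ^ p) := by
  have h1 := h Astar
  unfold criterion at h1
  have h2 : ∀ i, (Y i - ((X i).transpose * Ahat).trace) ^ 2
      = (Y i - ((X i).transpose * Astar).trace) ^ 2
        - 2 * (ξ i * ((X i).transpose * (Ahat - Astar)).trace)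
        + ((X i).transpose * (Ahat - Astar)).trace ^ 2 := by
    intro i
    rw [hY i, Matrix.mul_sub, Matrix.trace_sub]
    ring
  rw [Finset.sum_congr rfl fun i _ => h2 i, Finset.sum_add_distrib, Finset.sum_sub_distrib,
    ← Finset.mul_sum] at h1
  rw [predDist_sq]
  linarith

/-- The basic inequality on the event where the stochastic term is controlled. -/
theorem predDist_sq_le_of_stochasticBound {X : Fin N → Matrix (Fin m) (Fin T) ℝ}
    {Y ξ : Fin N → ℝ} {Ahat Astar : Matrix (Fin m) (Fin T) ℝ}
    (hY : ∀ i, Y i = ((X i).transpose * Astar).trace + ξ i) {p τ : ℝ}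
    (h : IsSchattenEstimator X Y p (4 * τ) Ahat)
    (hξ : StochasticBound X ξ p τ (1 / 2) Ahat Astar) :
    predDist X Ahat Astar ^ 2 ≤ 8 * τ * ((1 / 2) ^ p * schattenNorm p (Ahat - Astar) ^ p
      + schattenNorm p Astar ^ p - schattenNorm p Ahat ^ p) := by
  have h1 := predDist_sq_le_of_isSchattenEstimator hY h
  have h2 := (le_abs_self _).trans hξ
  have h0 := sq_nonneg (predDist X Ahat Astar)
  -- For `p = 1` the inequality is doubled using `d² ≥ 0`; for `p < 1` the noise contributes `d²/2`,
  -- which is absorbed on the left. Both give the factor `8τ`.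
  split_ifs at h2 with hp
  · subst hp
    simp only [Real.rpow_one] at h1 ⊢
    linarith
  · have h3 : ((1 : ℝ) / 2) ^ (p - 1) = 2 * (1 / 2) ^ p := by
      rw [Real.rpow_sub_one (by norm_num)]
      ring
    rw [h3] at h2
    linarith

theorem exists_block_length (K : ℝ) {e : ℝ} (he : 0 < e) :
    ∃ a₀ : ℕ, 0 < a₀ ∧ ∀ a : ℕ, a₀ ≤ a → K * (2 / (a : ℝ)) ^ e ≤ 1 / 4 := by
  have h1 : Filter.Tendsto (fun a : ℕ => K * (2 / (a : ℝ)) ^ e) Filter.atTop (nhds 0) := by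
    have h2 := ((tendsto_const_div_atTop_nhds_zero_nat (2 : ℝ)).rpow_const
      (Or.inr he.le)).const_mul K
    rwa [Real.zero_rpow he.ne', mul_zero] at h2
  obtain ⟨n, hn⟩ := Filter.eventually_atTop.1
    (h1.eventually (ge_mem_nhds (by norm_num : (0 : ℝ) < 1 / 4)))
  -- The shift keeps `a` positive, so that blocks have positive length.
  exact ⟨n + 1, n.succ_pos, fun a ha => hn a (by omega)⟩

/-- Deterministic error bounds for the Schatten estimator. -/
theorem estimation_bounds {X : Fin N → Matrix (Fin m) (Fin T) ℝ} {Y ξ : Fin N → ℝ}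
    {Ahat Astar : Matrix (Fin m) (Fin T) ℝ} {a r : ℕ} {p ν δ τ : ℝ} (hp0 : 0 < p) (hp1 : p ≤ 1)
    (hY : ∀ i, Y i = ((X i).transpose * Astar).trace + ξ i) (hrank : Astar.rank ≤ r)
    (hRI : RestrictedIsometry X ((2 + a) * r) ν δ) (hδ : δ ≤ 1 / 4) (hτ : 0 < τ) (ha : 0 < a)
    (hK : ((1 + (1 / 2) ^ p) / (1 - (1 / 2) ^ p)) ^ (1 / p) * (2 / (a : ℝ)) ^ (1 / p - 1 / 2)
      ≤ 1 / 4)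
    (h : IsSchattenEstimator X Y p (4 * τ) Ahat)
    (hξ : StochasticBound X ξ p τ (1 / 2) Ahat Astar) :
    predDist X Ahat Astar ^ 2
        ≤ 96 ^ (2 / (2 - p)) * r * τ ^ (2 / (2 - p)) * ν ^ (2 * p / (2 - p)) ∧
      ∀ q ∈ Set.Icc p 2, schattenNorm q (Ahat - Astar) ^ q ≤
        (96 ^ (2 / (2 - p)) * (6 * (1 + (1 + (1 / 2) ^ p) / (1 - (1 / 2) ^ p)) + 16)) * r *
          τ ^ (q / (2 - p)) * ν ^ (2 * q / (2 - p)) := by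
  -- Restricted isometry includes `1 ≤ (2 + a) r`, which excludes `r = 0`.
  have hr : 0 < r := Nat.pos_of_ne_zero fun h0 => by
    have := hRI.one_le
    simp [h0] at this
  set L := samplingLin X ∘ₗ
    (Matrix.toEuclideanLin (𝕜 := ℝ) (m := Fin m) (n := Fin T)).symm.toLinearMap
  have hLA : ∀ A, L (Matrix.toEuclideanLin A) = sampling X A := fun A =>
    congrArg (sampling X) (LinearEquiv.symm_apply_apply _ A)
  have hL : ∀ f : EuclideanSpace ℝ (Fin T) →ₗ[ℝ] EuclideanSpace ℝ (Fin m),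
      Module.finrank ℝ (LinearMap.range f) ≤ (2 + a) * r →
      (1 - δ) * ‖hsVec f‖ ≤ ν * ‖L f‖ ∧ ν * ‖L f‖ ≤ (1 + δ) * ‖hsVec f‖ := by
    intro f hf
    obtain ⟨A, rfl⟩ := (Matrix.toEuclideanLin (𝕜 := ℝ) (m := Fin m) (n := Fin T)).surjective f
    rw [finrank_range_toEuclideanLin] at hf
    rw [hLA, ← schattenNorm_two]
    exact hRI.bounds A hf
  have hbasic := predDist_sq_le_of_stochasticBound hY h hξ
  have hsum : Matrix.toEuclideanLin Astar + Matrix.toEuclideanLin (Ahat - Astar)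
      = Matrix.toEuclideanLin Ahat := by
    rw [← map_add, add_sub_cancel]
  rw [schattenNorm_rpow hp0, schattenNorm_rpow hp0, schattenNorm_rpow hp0, ← hsum, predDist, ← hLA]
    at hbasic
  obtain ⟨h1, h2⟩ := error_bounds_of_basic_inequality L ha hr hδ hp0 hp1 (by positivity)
    (Real.rpow_lt_one (by norm_num) (by norm_num) hp0) hK hL hRI.scale_pos hτ
    ((finrank_range_toEuclideanLin Astar).trans_le hrank) hbasic
  refine ⟨by rwa [predDist, ← hLA], fun q hq => ?_⟩
  rw [schattenNorm_rpow (hp0.trans_le hq.1)]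
  exact h2 q hq

end Matrices

end TraceRegression

open TraceRegression in
theorem theorem2 (p : ℝ) (hp0 : 0 < p) (hp1 : p ≤ 1) :
    ∃ (a₀ : ℕ) (δ₀ C₁ : ℝ) (C₂ : ℝ → ℝ), 0 < δ₀ ∧ 0 < C₁ ∧ (∀ q, 0 < C₂ q) ∧
      ∀ (a : ℕ), a₀ ≤ a →
      ∀ (m T N r : ℕ) (X : Fin N → Matrix (Fin m) (Fin T) ℝ)
        (Astar : Matrix (Fin m) (Fin T) ℝ), Astar.rank ≤ r →
      ∀ (ν δ : ℝ), RestrictedIsometry X ((2 + a) * r) ν δ → δ ≤ δ₀ →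
      ∀ (Ω : Type*) [MeasurableSpace Ω] (μ : Measure Ω) [IsProbabilityMeasure μ]
        (ξ Y : Fin N → Ω → ℝ), (∀ i ω, Y i ω = ((X i).transpose * Astar).trace + ξ i ω) →
      ∀ (τ ε : ℝ), 0 < τ → 0 < ε →
      ∀ (Ahat : Ω → Matrix (Fin m) (Fin T) ℝ),
        (∀ ω, IsSchattenEstimator X (fun i => Y i ω) p (4 * τ) (Ahat ω)) →
        (∀ t : ℝ, 0 < t →
          1 - ε ≤ μ.real {ω | StochasticBound X (fun i => ξ i ω) p τ t (Ahat ω) Astar}) →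
        1 - ε ≤ μ.real {ω |
          predDist X (Ahat ω) Astar ^ 2 ≤
              C₁ * r * τ ^ (2 / (2 - p)) * ν ^ (2 * p / (2 - p)) ∧
            ∀ q ∈ Set.Icc p 2, schattenNorm q (Ahat ω - Astar) ^ q ≤
              C₂ q * r * τ ^ (q / (2 - p)) * ν ^ (2 * q / (2 - p))} := by
  have he : 0 < 1 / p - 1 / 2 := by
    have : 1 ≤ 1 / p := by rw [le_div_iff₀ hp0]; linarith
    linarith
  obtain ⟨a₀, ha₀, hK⟩ :=
    exists_block_length (((1 + (1 / 2) ^ p) / (1 - (1 / 2) ^ p)) ^ (1 / p)) he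
  have hθ : (0 : ℝ) < 1 - (1 / 2) ^ p :=
    sub_pos.2 (Real.rpow_lt_one (by norm_num) (by norm_num) hp0)
  refine ⟨a₀, 1 / 4, 96 ^ (2 / (2 - p)),
    fun _ => 96 ^ (2 / (2 - p)) * (6 * (1 + (1 + (1 / 2) ^ p) / (1 - (1 / 2) ^ p)) + 16),
    by norm_num, by positivity, fun _ => by positivity, ?_⟩
  intro a ha m T N r X Astar hrank ν δ hRI hδ Ω _ μ _ ξ Y hY τ ε hτ _ Ahat hmin hstoch
  -- The noise event at `1/2` is contained in the target event; the bounds hold for each `ω` in it,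
  -- hence for all `q` at once.
  refine (hstoch (1 / 2) (by norm_num)).trans (measureReal_mono fun ω hω => ?_)
  exact estimation_bounds hp0 hp1 (fun i => hY i ω) hrank hRI hδ hτ (ha₀.trans_le ha) (hK a ha)
    (hmin ω) hω
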